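/- Let $n\ge 1$, let $b_1,b_2\in C([0,\infty))\cap L^1([0,\infty))$ be nonnegative, and let $p,q>1$ satisfy $$\max\left\{\frac{p+2+q^{-1}}{pq-1},\frac{q+2+p^{-1}}{pq-1}\right\}>\frac{n-1}{2}.$$ Let $R>0$ and let $u_0,v_0\in H^1(\mathbb R^n)$, $u_1,v_1\in L^2(\mathbb R^n)$ be nonnegative, supported in $B_R=\{x\in\mathbb R^n:|x|\le R\}$, and pairwise nontrivial, i.e. $(u_0,u_1)\ne(0,0)$ and $(v_0,v_1)\neq(0,0)$. For $\varepsilon>0$ consider the Cauchy problem $$u_{tt}-\Delta u+b_1(t)u_t=|v|^p,\qquad v_{tt}-\Delta v+b_2(t)v_t=|u|^q,\qquad x\in\mathbb R^n,\ t>0,$$ $$(u,u_t,v,v_t)(0,x)=\varepsilon\,(u_0,u_1,v_0,v_1)(x),\qquad x\in\mathbb R^n.$$ For $T\in(0,\infty]$, an energy solution on $[0,T)$ is a pair $(u,v)$ with $$u\in C([0,T),H^1(\mathbb R^n))\cap C^1([0,T),L^2(\mathbb R^n))\cap L^q_{\mathrm{loc}}([0,T)\times\mathbb R^n),$$ $$v\in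 C([0,T),H^1(\mathbb R^n))\cap C^1([0,T),L^2(\mathbb R^n))\cap L^p_{\mathrm{loc}}([0,T)\times\mathbb R^n),$$ such that $u(0)=\varepsilon u_0$, $v(0)=\varepsilon v_0$ and, for every $\phi\in C_0^\infty([0,T)\times\mathbb R^n)$ and every $t\in[0,T)$, $$\int_{\mathbb R^n}\partial_tu(t,x)\phi(t,x)\,dx-\int_{\mathbb R^n}\varepsilon u_1(x)\phi(0,x)\,dx-\int_0^t\!\!\int_{\mathbb R^n}\partial_tu\,\phi_s\,dx\,ds+\int_0^t\!\!\int_{\mathbb R^n}\nabla u\cdot\nabla\phi\,dx\,ds+\int_0^t\!\!\int_{\mathbb R^n}b_1(s)\,\partial_tu\,\phi\,dx\,ds=\int_0^t\!\!\int_{\mathbb R^n}|v|^p\phi\,dx\,ds,$$ together with the same identity with $(u,u_1,b_1,|v|^p)$ replaced by $(v,v_1,b_2,|u|^q)$. We consider energy solutions on $[0,T)$ with $$\operatorname{supp}u,\ \operatorname{supp}v\subset\{(t,x)\in[0,T)\times\mathbb R^n:|x|\le t+R\}.$$ The lifespan $T(\varepsilon)\in(0,\infty]$ of such a solution is the supremum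 of all $T'\ge T$ such that it extends to an energy solution on $[0,T')$ whose components are supported in $\{(t,x)\in[0,T')\times\mathbb R^n:|x|\le t+R\}$; the solution blows up in finite time if $T(\varepsilon)<\infty$. Then there exist $\varepsilon_0>0$ and $C>0$, depending only on $u_0,u_1,v_0,v_1,n,p,q,b_1,b_2,R$ (in particular not on $\varepsilon$), such that for every $\varepsilon\in(0,\varepsilon_0]$ every such solution $(u,v)$ blows up in finite time, and its lifespan satisfies $$T(\varepsilon)\le C\,\varepsilon^{-1/\max\{F(n,p,q),F(n,q,p)\}},\qquad F(n,p,q)=\frac{p+2+q^{-1}}{pq-1}-\frac{n-1}{2}.$$ -/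

import Mathlib

open MeasureTheory Set
open scoped ENNReal ContDiff InnerProductSpace

noncomputable section

namespace DampedWaveSystem

/-- The Euclidean space `ℝⁿ`. -/
abbrev Space (n : ℕ) : Type := EuclideanSpace ℝ (Fin n)

/-- The real space `L²(ℝⁿ)`. -/
abbrev L2 (n : ℕ) : Type := Lp ℝ 2 (volume : Measure (Space n))

/-- The space `L²(ℝⁿ; ℝⁿ)` of square integrable vector fields. -/
abbrev L2Vec (n : ℕ) : Type := Lp (Space n) 2 (volume : Measure (Space n))

/-- `g` is the weak (distributional) gradient of `f` on `ℝⁿ`, tested against all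
`χ ∈ C_c^∞(ℝⁿ)` in all directions `w`. It is used for `f`, `g` in `L²` only, so that the
integrals converge. -/
def HasWeakGradient {n : ℕ} (f : Space n → ℝ) (g : Space n → Space n) : Prop :=
  ∀ χ : Space n → ℝ, ContDiff ℝ ∞ χ → HasCompactSupport χ → ∀ w : Space n,
    ∫ x, f x * fderiv ℝ χ x w = - ∫ x, ⟪g x, w⟫_ℝ * χ x

/-- `f ∈ H¹(ℝⁿ)`. -/
def MemH1 {n : ℕ} (f : Space n → ℝ) : Prop :=
  MemLp f 2 ∧ ∃ g : Space n → Space n, MemLp g 2 ∧ HasWeakGradient f g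

/-- The time interval `[0, T)` for `T ∈ [0, ∞]`. -/
def timeInterval (T : ℝ≥0∞) : Set ℝ := {t | 0 ≤ t ∧ ENNReal.ofReal t < T}

/-- `u ∈ C([0,T), H¹) ∩ C¹([0,T), L²) ∩ L^r_loc([0,T) × ℝⁿ)`, with time derivative `ut = ∂ₜu`
and weak spatial gradient `Du = ∇u`. Continuity in `H¹` is continuity of `u` and of `∇u` in `L²`.
Every compact subset of `[0,T) × ℝⁿ` lies in some `[0,t] × K` with `t ∈ [0,T)`, `K` compact. -/
structure EnergyClass {n : ℕ} (T : ℝ≥0∞) (r : ℝ) (u ut : ℝ → L2 n) (Du : ℝ → L2Vec n) :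
    Prop where
  continuousOn : ContinuousOn u (timeInterval T)
  hasWeakGradient : ∀ t ∈ timeInterval T, HasWeakGradient (u t) (Du t)
  continuousOn_gradient : ContinuousOn Du (timeInterval T)
  hasDeriv : ∀ t ∈ timeInterval T, HasDerivWithinAt u (ut t) (timeInterval T) t
  continuousOn_deriv : ContinuousOn ut (timeInterval T)
  locIntegrable : ∀ t ∈ timeInterval T, ∀ K : Set (Space n), IsCompact K →
    ∫⁻ s in Icc 0 t, ∫⁻ x in K, ENNReal.ofReal (|u s x| ^ r) < ⊤

/-- `φ ∈ C_0^∞([0,T) × ℝⁿ)`: the restriction to `t ≥ 0` of a smooth function on `ℝ × ℝⁿ` with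
compact support in `{t < T}`. -/
structure IsTestFunction {n : ℕ} (T : ℝ≥0∞) (φ : ℝ × Space n → ℝ) : Prop where
  contDiff : ContDiff ℝ ∞ φ
  hasCompactSupport : HasCompactSupport φ
  tsupport_subset : ∀ z ∈ tsupport φ, ENNReal.ofReal z.1 < T

/-- The weak form on `[0,T)` of `u_tt - Δu + b(t) u_t = |v|^r`, `u_t(0) = ε f₁`, where `ut = ∂ₜu`
and `Du = ∇u`. -/
def WeakWaveEquation {n : ℕ} (b : ℝ → ℝ) (r ε : ℝ) (f₁ : Space n → ℝ) (T : ℝ≥0∞)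
    (ut : ℝ → L2 n) (Du : ℝ → L2Vec n) (v : ℝ → L2 n) : Prop :=
  ∀ φ : ℝ × Space n → ℝ, IsTestFunction T φ → ∀ t ∈ timeInterval T,
    (∫ x, ut t x * φ (t, x)) - (∫ x, ε * f₁ x * φ (0, x))
      - (∫ s in (0 : ℝ)..t, ∫ x, ut s x * deriv (fun τ => φ (τ, x)) s)
      + (∫ s in (0 : ℝ)..t, ∫ x, ⟪Du s x, gradient (fun y => φ (s, y)) x⟫_ℝ)
      + (∫ s in (0 : ℝ)..t, ∫ x, b s * ut s x * φ (s, x))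
    = ∫ s in (0 : ℝ)..t, ∫ x, |v s x| ^ r * φ (s, x)

/-- `(u, v)` is an energy solution on `[0,T)` of
`u_tt - Δu + b₁(t) u_t = |v|^p`, `v_tt - Δv + b₂(t) v_t = |u|^q`,
`(u, u_t, v, v_t)(0) = ε (u₀, u₁, v₀, v₁)`. -/
def IsEnergySolution {n : ℕ} (b₁ b₂ : ℝ → ℝ) (p q ε : ℝ) (u₀ u₁ v₀ v₁ : Space n → ℝ)
    (T : ℝ≥0∞) (u v : ℝ → L2 n) : Prop :=
  ∃ (ut vt : ℝ → L2 n) (Du Dv : ℝ → L2Vec n),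
    EnergyClass T q u ut Du ∧ EnergyClass T p v vt Dv ∧
    (u 0 =ᵐ[volume] fun x => ε * u₀ x) ∧ (v 0 =ᵐ[volume] fun x => ε * v₀ x) ∧
    WeakWaveEquation b₁ p ε u₁ T ut Du v ∧
    WeakWaveEquation b₂ q ε v₁ T vt Dv u

/-- `supp u ⊆ {(t,x) ∈ [0,T) × ℝⁿ : |x| ≤ t + R}`. -/
def SupportedInCone {n : ℕ} (R : ℝ) (T : ℝ≥0∞) (u : ℝ → L2 n) : Prop :=
  ∀ t ∈ timeInterval T, ∀ᵐ x : Space n, t + R < ‖x‖ → u t x = 0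

/-- The lifespan of a solution `(u, v)` given on `[0,T)`: the supremum of all `T' ≥ T` such that
`(u, v)` extends to an energy solution on `[0,T')` which is supported in the cone
`|x| ≤ t + R`. -/
def lifespan {n : ℕ} (b₁ b₂ : ℝ → ℝ) (p q ε : ℝ) (u₀ u₁ v₀ v₁ : Space n → ℝ) (R : ℝ)
    (T : ℝ≥0∞) (u v : ℝ → L2 n) : ℝ≥0∞ :=
  sSup {T' | T ≤ T' ∧ ∃ u' v' : ℝ → L2 n,
    IsEnergySolution b₁ b₂ p q ε u₀ u₁ v₀ v₁ T' u' v' ∧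
    SupportedInCone R T' u' ∧ SupportedInCone R T' v' ∧
    ∀ t ∈ timeInterval T, u' t = u t ∧ v' t = v t}

/-- `F(n,p,q) = (p + 2 + q⁻¹)/(pq - 1) - (n - 1)/2`. -/
def F (n : ℕ) (p q : ℝ) : ℝ := (p + 2 + q⁻¹) / (p * q - 1) - ((n : ℝ) - 1) / 2

end DampedWaveSystem

end

open DampedWaveSystem

noncomputable section

namespace DampedWaveSystem

/-! Because each `b` is nonnegative and integrable, the factor `exp ∫ b` lies between `1` and a
constant `M`: damping costs only constants, and the argument is that for the undamped system. The
cone condition lets one test with smooth functions of `x` that are not compactly supported. The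
weight `1` removes the Laplacian, so `U = ∫ u` satisfies `U'' + b₁ U' = ∫ |v|^p` in integrated form
(`le_integral_of_source_ge`). The weight `Φ = radialExp n`, where `ΔΦ = Φ`, gives `W'' + b W' = W +
(nonnegative source)` for `W = ∫ vΦ`, hence `W ≥ c ε e^t` for `t ≥ 1` (`exp_le_integral_radialExp`).

Since `Φ(x) ≤ C (1+|x|)^(-(n-1)/2) e^|x|`, Hölder's inequality on `|x| ≤ t + R` turns this into `∫
|v|^p ≥ c ε^p L^((n-1)(1-p/2))` for `t` in `[L, 4L]`, and two integrations give `U ≥ c ε^p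
L^((n-1)(1-p/2)+2)` on `[2L, 4L]` (`exists_mean_ge_of_data`). Hölder with weight `1` supplies the
feedback: a lower bound for one mean improves to a lower bound for the other (`exists_mean_step`).
Iterating it over shrinking time steps shows that a solution living past `4L` cannot have `U ≥ K
L^(n-(2p+2)/(pq-1))` throughout `[2L, 4L]` (`exists_blowup_threshold`).

Comparing the two bounds for `U` leaves `c ε^p L^(p F(n,q,p)) < K`, that is, `L` is at most a
constant times `ε^(-1/F(n,q,p))` (`existenceTime_le`). Exchanging `u` and `v` gives the exponent
`F(n,p,q)`, and the better of the two is kept. -/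

/-! ### The Bessel-type series and its growth. -/

/-- The product `∏_{j<k} (4j + 2ν)`. -/
def besselDenom (ν : ℝ) (k : ℕ) : ℝ := ∏ j ∈ Finset.range k, (4 * (j : ℝ) + 2 * ν)

theorem besselDenom_pos {ν : ℝ} (hν : 0 < ν) (k : ℕ) : 0 < besselDenom ν k :=
  Finset.prod_pos fun j _ => by positivity

theorem besselDenom_succ (ν : ℝ) (k : ℕ) :
    besselDenom ν (k + 1) = besselDenom ν k * (4 * (k : ℝ) + 2 * ν) :=
  Finset.prod_range_succ _ _

theorem besselDenom_succ' (ν : ℝ) (k : ℕ) :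
    besselDenom ν (k + 1) = 2 * ν * besselDenom (ν + 2) k := by
  unfold besselDenom
  rw [Finset.prod_range_succ', mul_comm]
  congr 1
  · simp
  · exact Finset.prod_congr rfl fun j _ => by push_cast; ring

/-- Coefficients of the entire function `h` for which `h(|x|²)` is, for `ν = n`, the positive
radial solution of `ΔΦ = Φ` on `ℝⁿ`. -/
def besselCoeff (ν : ℝ) (k : ℕ) : ℝ := ((k.factorial : ℝ) * besselDenom ν k)⁻¹

theorem besselCoeff_pos {ν : ℝ} (hν : 0 < ν) (k : ℕ) : 0 < besselCoeff ν k := by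
  have := besselDenom_pos hν k
  unfold besselCoeff
  positivity

theorem besselCoeff_zero (ν : ℝ) : besselCoeff ν 0 = 1 := by
  simp [besselCoeff, besselDenom]

theorem succ_mul_besselCoeff_succ {ν : ℝ} (hν : 0 < ν) (k : ℕ) :
    ((k : ℝ) + 1) * besselCoeff ν (k + 1) = (2 * ν)⁻¹ * besselCoeff (ν + 2) k := by
  have := besselDenom_pos (show 0 < ν + 2 by linarith) k
  have hk : (k.factorial : ℝ) ≠ 0 := by positivity
  unfold besselCoeff
  rw [besselDenom_succ', Nat.factorial_succ]
  push_cast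
  field_simp

theorem besselCoeff_contiguous {ν : ℝ} (hν : 0 < ν) (k : ℕ) :
    besselCoeff ν (k + 1) =
      besselCoeff (ν + 2) (k + 1) + (ν * (ν + 2))⁻¹ * besselCoeff (ν + 4) k := by
  have h4 := besselDenom_pos (show 0 < ν + 4 by linarith) k
  have h0 := besselDenom_pos hν (k + 1)
  have hk : (k.factorial : ℝ) ≠ 0 := by positivity
  have e1 : besselDenom (ν + 2) (k + 1) = 2 * (ν + 2) * besselDenom (ν + 4) k := by
    rw [besselDenom_succ']; ring_nf
  have e2 : besselDenom ν (k + 1) * (4 * ((k : ℝ) + 1) + 2 * ν) =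
      2 * ν * (2 * (ν + 2) * besselDenom (ν + 4) k) := by
    rw [← e1, ← besselDenom_succ', besselDenom_succ ν (k + 1)]; push_cast; ring
  have hpos : 0 < 4 * ((k : ℝ) + 1) + 2 * ν := by positivity
  have e3 : besselDenom ν (k + 1) =
      2 * ν * (2 * (ν + 2) * besselDenom (ν + 4) k) / (4 * ((k : ℝ) + 1) + 2 * ν) := by
    rw [eq_div_iff hpos.ne', e2]
  unfold besselCoeff
  rw [e3, e1, Nat.factorial_succ]
  push_cast
  field_simp
  ring

theorem summable_besselCoeff {ν : ℝ} (hν : 0 < ν) (y : ℝ) :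
    Summable fun k => besselCoeff ν k * y ^ k := by
  refine Summable.of_norm_bounded (Real.summable_pow_div_factorial (|y| / (2 * ν))) fun k => ?_
  have h1 : (2 * ν) ^ k ≤ besselDenom ν k := by
    unfold besselDenom
    rw [← Finset.card_range k, ← Finset.prod_const]
    simp only [Finset.card_range]
    refine Finset.prod_le_prod (fun j _ => by positivity) fun j _ => ?_
    have : (0 : ℝ) ≤ j := by positivity
    linarith
  rw [norm_mul, norm_pow, Real.norm_eq_abs, Real.norm_eq_abs,
    abs_of_pos (besselCoeff_pos hν k), div_pow, besselCoeff, mul_inv, div_div,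
    div_eq_mul_inv, mul_comm (_ * _) (|y| ^ k)]
  gcongr
  rw [← mul_inv, mul_comm]
  gcongr

/-- The entire function `∑ y^k / (k! ∏_{j<k} (4j + 2ν))`. -/
def besselSeries (ν y : ℝ) : ℝ := ∑' k, besselCoeff ν k * y ^ k

theorem hasDerivAt_besselSeries {ν : ℝ} (hν : 0 < ν) (y : ℝ) :
    HasDerivAt (besselSeries ν) ((2 * ν)⁻¹ * besselSeries (ν + 2) y) y := by
  have key : ∀ k : ℕ, ∀ z : ℝ, besselCoeff ν (k + 1) * (((k + 1 : ℕ) : ℝ) * z ^ k) =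
      (2 * ν)⁻¹ * (besselCoeff (ν + 2) k * z ^ k) := fun k z => by
    have := succ_mul_besselCoeff_succ hν k
    push_cast
    linear_combination z ^ k * this
  have h2 : (0 : ℝ) < ν + 2 := by linarith
  have hs : ∀ z : ℝ, Summable fun k : ℕ => besselCoeff ν k * ((k : ℝ) * z ^ (k - 1)) := fun z => by
    rw [← summable_nat_add_iff 1]
    simp only [Nat.add_sub_cancel, key]
    exact (summable_besselCoeff h2 z).mul_left _
  have hd := hasDerivAt_tsum_of_isPreconnected (𝕜 := ℝ) (F := ℝ)
    (g := fun k z => besselCoeff ν k * z ^ k)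
    (g' := fun k z => besselCoeff ν k * ((k : ℝ) * z ^ (k - 1))) (t := Metric.ball 0 (|y| + 1))
    (y₀ := 0) (y := y) (hs (|y| + 1)) Metric.isOpen_ball
    (convex_ball (0 : ℝ) _).isPreconnected
    (fun k z _ => (hasDerivAt_pow k z).const_mul _)
    (fun k z hz => by
      rw [norm_mul, norm_mul, norm_pow, Real.norm_eq_abs, Real.norm_eq_abs, Real.norm_eq_abs,
        abs_of_pos (besselCoeff_pos hν k), Nat.abs_cast]
      have hz' : |z| ≤ |y| + 1 := by simpa using (mem_ball_zero_iff.1 hz).le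
      have := besselCoeff_pos hν k
      gcongr)
    (Metric.mem_ball_self (by positivity)) (summable_besselCoeff hν 0)
    (by simp)
  have he : ∑' k : ℕ, besselCoeff ν k * ((k : ℝ) * y ^ (k - 1)) =
      (2 * ν)⁻¹ * besselSeries (ν + 2) y := by
    rw [(hs y).tsum_eq_zero_add]
    simp only [Nat.add_sub_cancel, key]
    rw [tsum_mul_left]
    simp [besselSeries]
  rw [he] at hd
  exact hd

/-- Together with `hasDerivAt_besselSeries`, this is the radial equation `f'' + (ν-1) f'/r = f` for
`f(r) = besselSeries ν (r²)`. -/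
theorem besselSeries_contiguous {ν : ℝ} (hν : 0 < ν) (y : ℝ) :
    besselSeries ν y =
      besselSeries (ν + 2) y + (ν * (ν + 2))⁻¹ * (y * besselSeries (ν + 4) y) := by
  have s0 := summable_besselCoeff hν y
  have s2 := summable_besselCoeff (show 0 < ν + 2 by linarith) y
  have s4 := summable_besselCoeff (show 0 < ν + 4 by linarith) y
  unfold besselSeries
  rw [s0.tsum_eq_zero_add, s2.tsum_eq_zero_add, ← tsum_mul_left, ← tsum_mul_left, add_assoc,
    ← ((summable_nat_add_iff 1).2 s2).tsum_add ((s4.mul_left y).mul_left _)]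
  simp only [besselCoeff_zero, besselCoeff_contiguous hν]
  congr 1
  exact tsum_congr fun k => by ring

theorem one_le_besselSeries {ν : ℝ} (hν : 0 < ν) {y : ℝ} (hy : 0 ≤ y) : 1 ≤ besselSeries ν y := by
  have := (summable_besselCoeff hν y).le_tsum 0 fun k _ =>
    mul_nonneg (besselCoeff_pos hν k).le (pow_nonneg hy k)
  simpa [besselCoeff_zero, besselSeries] using this

theorem contDiff_besselSeries {ν : ℝ} (hν : 0 < ν) : ContDiff ℝ ∞ (besselSeries ν) := by
  rw [contDiff_infty]
  intro m
  induction m generalizing ν with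
  | zero =>
    exact contDiff_zero.2 (continuous_iff_continuousAt.2 fun y =>
      (hasDerivAt_besselSeries hν y).continuousAt)
  | succ m ih =>
    push_cast
    rw [contDiff_succ_iff_deriv]
    refine ⟨fun y => (hasDerivAt_besselSeries hν y).differentiableAt, by simp, ?_⟩
    have : deriv (besselSeries ν) = fun y => (2 * ν)⁻¹ * besselSeries (ν + 2) y :=
      funext fun y => (hasDerivAt_besselSeries hν y).deriv
    rw [this]
    exact contDiff_const.mul (ih (by linarith))

/-- Growth of the radial solution `f(r) = h(r²)`. -/
theorem exists_besselSeries_sq_le {ν : ℝ} (hν : 1 ≤ ν) :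
    ∃ C, 0 < C ∧ ∀ r, 0 ≤ r →
      besselSeries ν (r ^ 2) ≤ C * ((1 + r) ^ (-((ν - 1) / 2)) * Real.exp r) := by
  have hν0 : 0 < ν := by linarith
  have hν2 : 0 < ν + 2 := by linarith
  have hν4 : 0 < ν + 4 := by linarith
  obtain ⟨m, hm⟩ : ∃ m, m = (ν - 1) / 2 := ⟨_, rfl⟩
  have hm0 : 0 ≤ m := by rw [hm]; linarith
  have hνm : ν = 2 * m + 1 := by rw [hm]; ring
  rw [← hm]
  let f : ℝ → ℝ := fun r => besselSeries ν (r ^ 2)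
  let f' : ℝ → ℝ := fun r => (2 * ν)⁻¹ * besselSeries (ν + 2) (r ^ 2) * (2 * r)
  have hf1 : ∀ r, 1 ≤ f r := fun r => one_le_besselSeries hν0 (sq_nonneg r)
  have hf'0 : ∀ r, 0 ≤ r → 0 ≤ f' r := fun r hr => by
    have := one_le_besselSeries hν2 (sq_nonneg r)
    have : 0 ≤ besselSeries (ν + 2) (r ^ 2) := by linarith
    simp only [f']; positivity
  have hf : ∀ r, HasDerivAt f (f' r) r := fun r => by
    have := (hasDerivAt_besselSeries hν0 (r ^ 2)).comp r (hasDerivAt_pow 2 r)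
    simpa [f, f', Function.comp_def] using this
  have hf' : ∀ r, 0 < r → HasDerivAt f' (f r - 2 * m * f' r / r) r := fun r hr => by
    have h1 := (hasDerivAt_besselSeries hν2 (r ^ 2)).comp r (hasDerivAt_pow 2 r)
    have h2 := (h1.const_mul (2 * ν)⁻¹).mul ((hasDerivAt_id r).const_mul 2)
    have h3 : HasDerivAt f' _ r := h2
    convert h3 using 1
    have hc := besselSeries_contiguous hν0 (r ^ 2)
    simp only [f, f', hc, Function.comp_apply, id]
    rw [show ν + 2 + 2 = ν + 4 by ring]
    simp only [Nat.cast_ofNat, Nat.add_one_sub_one, pow_one, mul_one]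
    rw [show m = (ν - 1) / 2 from hm]
    field_simp
    ring
  -- For `w = r^m f` the equation becomes `w'' = (1 + m(m-1)/r²) w`, and `z = w + w'`. The factor
  -- `exp (m²/r)`, bounded on `r ≥ 1`, absorbs the term `m(m-1)w/r²`, so that `G` decreases and `w ≤
  -- z ≤ G(1) e^r`.
  let z : ℝ → ℝ := fun r => r ^ m * (f r + f' r + m * f r / r)
  let G : ℝ → ℝ := fun r => Real.exp (-r + m ^ 2 / r) * z r
  have hG : ∀ r, 0 < r → HasDerivAt G (Real.exp (-r + m ^ 2 / r) *
      (-(r ^ m * (m * f r / r ^ 2)) - m ^ 2 / r ^ 2 * (r ^ m * (f' r + m * f r / r)))) r := by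
    intro r hr
    have hrm : HasDerivAt (fun r : ℝ => r ^ m) (m * (r ^ m / r)) r := by
      have := Real.hasDerivAt_rpow_const (p := m) (Or.inl hr.ne')
      rwa [Real.rpow_sub_one hr.ne'] at this
    have hz := hrm.mul (((hf r).add (hf' r hr)).add
      (((hf r).const_mul m).div (hasDerivAt_id r) hr.ne'))
    have he : HasDerivAt (fun r : ℝ => Real.exp (-r + m ^ 2 / r)) _ r :=
      (((hasDerivAt_id r).neg.add ((hasDerivAt_const r (m ^ 2)).div
        (hasDerivAt_id r) hr.ne'))).exp
    have h3 : HasDerivAt G _ r := he.mul hz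
    convert h3 using 1
    simp only [Pi.add_apply, Pi.neg_apply, Pi.div_apply, id, z]
    field_simp
    ring
  have hanti : AntitoneOn G (Ici 1) := by
    refine antitoneOn_of_deriv_nonpos (convex_Ici 1) ?_ ?_ ?_
    · exact fun r hr => (hG r (by linarith [mem_Ici.1 hr])).continuousAt.continuousWithinAt
    · intro r hr
      rw [interior_Ici] at hr
      exact (hG r (by linarith [mem_Ioi.1 hr])).differentiableAt.differentiableWithinAt
    · intro r hr
      rw [interior_Ici] at hr
      have hr0 : 0 < r := by linarith [mem_Ioi.1 hr]
      rw [(hG r hr0).deriv]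
      have h1 := hf1 r
      have h2 := hf'0 r hr0.le
      have h3 : 0 ≤ f r := by linarith
      refine mul_nonpos_of_nonneg_of_nonpos (Real.exp_pos _).le ?_
      have : 0 ≤ r ^ m * (m * f r / r ^ 2) := by positivity
      have : 0 ≤ m ^ 2 / r ^ 2 * (r ^ m * (f' r + m * f r / r)) := by positivity
      linarith
  have hmono : MonotoneOn f (Ici 0) := by
    refine monotoneOn_of_deriv_nonneg (convex_Ici 0)
      (fun r _ => (hf r).continuousAt.continuousWithinAt)
      (fun r _ => (hf r).differentiableAt.differentiableWithinAt) ?_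
    intro r hr
    rw [interior_Ici] at hr
    rw [(hf r).deriv]
    exact hf'0 r (le_of_lt hr)
  have hG1 : 0 ≤ G 1 := by
    have h2 := hf'0 1 zero_le_one
    have h3 := hf1 1
    have h4 : 0 ≤ f 1 := by linarith
    simp only [G, z]; positivity
  refine ⟨2 ^ m * (G 1 + f 1), by have := hf1 1; positivity, fun r hr => ?_⟩
  change f r ≤ _
  have hf0 : 0 ≤ f r := zero_le_one.trans (hf1 r)
  have hf10 : 0 ≤ f 1 := zero_le_one.trans (hf1 1)
  have hpos : 0 < (1 + r) ^ (-m) := Real.rpow_pos_of_pos (by linarith) _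
  have h2m : (0 : ℝ) < 2 ^ m := Real.rpow_pos_of_pos two_pos _
  rcases le_total r 1 with h | h
  · have e1 : 1 ≤ 2 ^ m * (1 + r) ^ (-m) := by
      rw [Real.rpow_neg (by linarith), ← div_eq_mul_inv, one_le_div (by positivity)]
      exact Real.rpow_le_rpow (by linarith) (by linarith) hm0
    have e2 : 1 ≤ Real.exp r := Real.one_le_exp hr
    calc f r ≤ f 1 := hmono hr (zero_le_one' ℝ) h
      _ ≤ (G 1 + f 1) * (2 ^ m * (1 + r) ^ (-m)) * Real.exp r := by
        have : f 1 ≤ G 1 + f 1 := by linarith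
        calc f 1 ≤ (G 1 + f 1) * 1 * 1 := by linarith
          _ ≤ _ := by gcongr
      _ = _ := by ring
  · have hr0 : 0 < r := by linarith
    have e1 : r ^ (-m) ≤ 2 ^ m * (1 + r) ^ (-m) := by
      rw [Real.rpow_neg (by linarith), Real.rpow_neg (by linarith), ← div_eq_mul_inv,
        le_div_iff₀ (by positivity), inv_mul_le_iff₀ (by positivity),
        ← Real.mul_rpow (by linarith) (by linarith)]
      exact Real.rpow_le_rpow (by linarith) (by linarith) hm0
    have e2 : G r ≤ G 1 := hanti (mem_Ici.2 le_rfl) h h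
    have e3 : f r = r ^ (-m) * (r ^ m * f r) := by
      rw [← mul_assoc, ← Real.rpow_add hr0]; simp
    have e4 : r ^ m * f r ≤ z r := by
      have := hf'0 r hr
      have : 0 ≤ m * f r / r := by positivity
      simp only [z]; gcongr; linarith
    have e5 : Real.exp (-r) * z r ≤ G r := by
      have : 0 ≤ z r := le_trans (by positivity) e4
      simp only [G]
      gcongr
      have : 0 ≤ m ^ 2 / r := by positivity
      linarith
    have e6 : z r ≤ G 1 * Real.exp r := by
      have := e5.trans e2
      rwa [Real.exp_neg, inv_mul_le_iff₀ (Real.exp_pos r), mul_comm] at this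
    calc f r = r ^ (-m) * (r ^ m * f r) := e3
      _ ≤ (2 ^ m * (1 + r) ^ (-m)) * (G 1 * Real.exp r) := by
        exact mul_le_mul e1 (e4.trans e6) (by positivity) (by positivity)
      _ ≤ (2 ^ m * (1 + r) ^ (-m)) * ((G 1 + f 1) * Real.exp r) := by gcongr; linarith
      _ = _ := by ring

/-! ### The radial solution of `ΔΦ = Φ` and integrals of its powers. -/

/-- The Laplacian of a function on `ℝⁿ`. -/
def lap {n : ℕ} (g : Space n → ℝ) (x : Space n) : ℝ :=
  ∑ i, fderiv ℝ (fun y => fderiv ℝ g y (EuclideanSpace.single i 1)) x (EuclideanSpace.single i 1)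

theorem lap_congr {n : ℕ} {g h : Space n → ℝ} {x : Space n} (H : g =ᶠ[nhds x] h) :
    lap g x = lap h x := by
  unfold lap
  refine Finset.sum_congr rfl fun i _ => ?_
  have : (fun y => fderiv ℝ g y (EuclideanSpace.single i 1)) =ᶠ[nhds x]
      fun y => fderiv ℝ h y (EuclideanSpace.single i 1) :=
    (H.fderiv (𝕜 := ℝ)).mono fun y hy => by simp only [hy]
  rw [this.fderiv_eq]

theorem lap_const {n : ℕ} (c : ℝ) (x : Space n) : lap (fun _ => c) x = 0 := by
  simp [lap]

/-- The positive radial solution of `ΔΦ = Φ` with `Φ(0) = 1`. -/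
def radialExp (n : ℕ) (x : Space n) : ℝ := besselSeries n (‖x‖ ^ 2)

theorem contDiff_radialExp {n : ℕ} (hn : 1 ≤ n) : ContDiff ℝ ∞ (radialExp n) :=
  (contDiff_besselSeries (by exact_mod_cast hn)).comp (contDiff_norm_sq ℝ)

theorem one_le_radialExp {n : ℕ} (hn : 1 ≤ n) (x : Space n) : 1 ≤ radialExp n x :=
  one_le_besselSeries (by exact_mod_cast hn) (sq_nonneg _)

theorem lap_radialExp {n : ℕ} (hn : 1 ≤ n) (x : Space n) :
    lap (radialExp n) x = radialExp n x := by
  have hn0 : (0 : ℝ) < n := by exact_mod_cast hn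
  have hn2 : (0 : ℝ) < n + 2 := by linarith
  have hsq : ∀ y : Space n, HasFDerivAt (fun y : Space n => ‖y‖ ^ 2) (2 • innerSL ℝ y) y :=
    fun y => (hasStrictFDerivAt_norm_sq y).hasFDerivAt
  have hd : ∀ (ν : ℝ), 0 < ν → ∀ (i : Fin n) (y : Space n),
      HasFDerivAt (fun y : Space n => besselSeries ν (‖y‖ ^ 2))
        (((2 * ν)⁻¹ * besselSeries (ν + 2) (‖y‖ ^ 2)) • (2 • innerSL ℝ y)) y := fun ν hν i y => by
    have := HasDerivAt.comp_hasFDerivAt y (hasDerivAt_besselSeries hν (‖y‖ ^ 2)) (hsq y)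
    exact this
  have h1 : ∀ (i : Fin n) (y : Space n), fderiv ℝ (radialExp n) y (EuclideanSpace.single i 1) =
      (n : ℝ)⁻¹ * (besselSeries (n + 2) (‖y‖ ^ 2) * y i) := fun i y => by
    unfold radialExp
    rw [(hd n hn0 i y).fderiv]
    simp [EuclideanSpace.inner_single_right]
    ring
  unfold lap
  simp only [h1]
  have h2 : ∀ i : Fin n, fderiv ℝ (fun y : Space n =>
      (n : ℝ)⁻¹ * (besselSeries (n + 2) (‖y‖ ^ 2) * y i)) x (EuclideanSpace.single i 1) =
      (n : ℝ)⁻¹ * (besselSeries (n + 2) (‖x‖ ^ 2) +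
        (n + 2 : ℝ)⁻¹ * besselSeries (n + 4) (‖x‖ ^ 2) * (x i) ^ 2) := fun i => by
    have hp : HasFDerivAt (fun y : Space n => y i) (EuclideanSpace.proj i : Space n →L[ℝ] ℝ) x :=
      (EuclideanSpace.proj i : Space n →L[ℝ] ℝ).hasFDerivAt
    have := ((hd (n + 2) hn2 i x).mul hp).const_mul (n : ℝ)⁻¹
    have e : fderiv ℝ (fun y : Space n =>
      (n : ℝ)⁻¹ * (besselSeries (n + 2) (‖y‖ ^ 2) * y i)) x = _ := this.fderiv
    rw [e]
    simp [EuclideanSpace.inner_single_right]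
    rw [show (n : ℝ) + 2 + 2 = n + 4 by ring]
    field_simp
  simp only [h2]
  rw [← Finset.mul_sum, Finset.sum_add_distrib, ← Finset.mul_sum, radialExp,
    besselSeries_contiguous hn0, EuclideanSpace.real_norm_sq_eq]
  simp
  field_simp

/-- Exponential decay away from the outer radius `ρ` pays for moving a power weight from `y` to `ρ`.
Only `a < 0` needs an argument: `1 + ρ ≤ (1+y)(1+(ρ-y))`, and `e^x ≥ 1 + x` at `x = κ(ρ-y)/|a|`. -/
theorem exists_one_add_rpow_le (a : ℝ) {κ : ℝ} (hκ : 0 < κ) :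
    ∃ D, 0 < D ∧ ∀ y ρ, 0 ≤ y → y ≤ ρ →
      (1 + y) ^ a ≤ D * ((1 + ρ) ^ a * Real.exp (κ * (ρ - y))) := by
  rcases le_or_gt 0 a with ha | ha
  · refine ⟨1, one_pos, fun y ρ hy hρ => ?_⟩
    rw [one_mul]
    have h1 : (1 + y) ^ a ≤ (1 + ρ) ^ a := Real.rpow_le_rpow (by linarith) (by linarith) ha
    have h2 : 1 ≤ Real.exp (κ * (ρ - y)) := Real.one_le_exp (mul_nonneg hκ.le (by linarith))
    exact h1.trans (le_mul_of_one_le_right (Real.rpow_nonneg (by linarith) _) h2)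
  · obtain ⟨b, hb, rfl⟩ : ∃ b, 0 < b ∧ a = -b := ⟨-a, by linarith, by ring⟩
    have hδ : 0 < κ / b := by positivity
    refine ⟨(1 + b / κ) ^ b, by positivity, fun y ρ hy hρ => ?_⟩
    have hρ0 : 0 ≤ ρ := hy.trans hρ
    have e1 : 1 + ρ ≤ (1 + b / κ) * (1 + y) * Real.exp (κ / b * (ρ - y)) := by
      have h3 : κ / b * (ρ - y) + 1 ≤ Real.exp (κ / b * (ρ - y)) := Real.add_one_le_exp _
      have h5 : 0 ≤ ρ - y := by linarith
      calc 1 + ρ ≤ (1 + y) * (1 + (ρ - y)) := by nlinarith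
        _ ≤ (1 + y) * ((1 + b / κ) * (κ / b * (ρ - y) + 1)) := by
          gcongr
          have : (1 + b / κ) * (κ / b * (ρ - y) + 1) =
            κ / b * (ρ - y) + 1 + (ρ - y) + b / κ := by field_simp; ring
          rw [this]
          have : 0 ≤ κ / b * (ρ - y) := by positivity
          have : 0 ≤ b / κ := by positivity
          linarith
        _ ≤ (1 + y) * ((1 + b / κ) * Real.exp (κ / b * (ρ - y))) := by gcongr
        _ = _ := by ring
    have e2 := Real.rpow_le_rpow (by linarith) e1 hb.le
    rw [Real.mul_rpow (by positivity) (by positivity), Real.mul_rpow (by positivity) (by positivity),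
      ← Real.exp_mul, show κ / b * (ρ - y) * b = κ * (ρ - y) by field_simp] at e2
    have hy' : 0 < (1 + y) ^ b := by positivity
    have hρ' : 0 < (1 + ρ) ^ b := by positivity
    rw [Real.rpow_neg (by linarith), Real.rpow_neg (by linarith), inv_le_iff_one_le_mul₀ hy']
    rw [show (1 + b / κ) ^ b * (((1 + ρ) ^ b)⁻¹ * Real.exp (κ * (ρ - y))) * (1 + y) ^ b =
      ((1 + b / κ) ^ b * (1 + y) ^ b * Real.exp (κ * (ρ - y))) / (1 + ρ) ^ b by ring,
      one_le_div hρ']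
    exact e2

/-- In polar coordinates the integrand is at most a constant times `(1+r)^((n-1)(1-s/2)) e^(sr)`.
Half of the exponential moves the power to `r = ρ`; the other half is integrated. -/
theorem exists_integral_radialExp_rpow_le {n : ℕ} (hn : 1 ≤ n) {s : ℝ} (hs : 0 < s) :
    ∃ C, 0 < C ∧ ∀ ρ, 0 ≤ ρ →
      ∫ x in Metric.closedBall (0 : Space n) ρ, radialExp n x ^ s ≤
        C * ((1 + ρ) ^ (((n : ℝ) - 1) * (1 - s / 2)) * Real.exp (s * ρ)) := by
  have : NeZero n := ⟨by omega⟩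
  have hn1 : (1 : ℝ) ≤ n := by exact_mod_cast hn
  obtain ⟨C, hC, hCf⟩ := exists_besselSeries_sq_le hn1
  obtain ⟨D, hD, hDf⟩ := exists_one_add_rpow_le (((n : ℝ) - 1) * (1 - s / 2)) (half_pos hs)
  obtain ⟨K, hK⟩ : ∃ K, K = (n : ℝ) * volume.real (Metric.ball (0 : Space n) 1) := ⟨_, rfl⟩
  have hK0 : 0 < K := by
    rw [hK]
    refine mul_pos (by linarith) ?_
    exact ENNReal.toReal_pos (Metric.measure_ball_pos _ _ one_pos).ne' measure_ball_lt_top.ne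
  let f : ℝ → ℝ := fun r => besselSeries n (r ^ 2)
  have hfc : Continuous f :=
    (contDiff_besselSeries (by linarith : (0 : ℝ) < n)).continuous.comp (continuous_pow 2)
  have hf1 : ∀ r, 1 ≤ f r := fun r => one_le_besselSeries (by linarith) (sq_nonneg r)
  obtain ⟨a, ha⟩ : ∃ a, a = ((n : ℝ) - 1) * (1 - s / 2) := ⟨_, rfl⟩
  rw [← ha] at hDf ⊢
  refine ⟨K * (C ^ s * D * (2 / s)), by positivity, fun ρ hρ => ?_⟩
  have e1 : ∫ x in Metric.closedBall (0 : Space n) ρ, radialExp n x ^ s =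
      K * ∫ r in (0 : ℝ)..ρ, r ^ (n - 1) * f r ^ s := by
    rw [← integral_indicator measurableSet_closedBall]
    have h1 : ∀ x : Space n, (Metric.closedBall (0 : Space n) ρ).indicator
        (fun x => radialExp n x ^ s) x = (Iic ρ).indicator (fun r => f r ^ s) ‖x‖ := fun x => by
      simp [indicator, radialExp, f]
    simp_rw [h1]
    rw [integral_fun_norm_addHaar, finrank_euclideanSpace_fin, nsmul_eq_mul, smul_eq_mul,
      ← mul_assoc, ← hK, intervalIntegral.integral_of_le hρ]
    congr 1
    have h2 : ∀ r : ℝ, r ^ (n - 1) • (Iic ρ).indicator (fun r => f r ^ s) r =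
        (Iic ρ).indicator (fun r => r ^ (n - 1) * f r ^ s) r := fun r => by
      by_cases h : r ∈ Iic ρ <;> simp [h]
    simp_rw [h2]
    rw [setIntegral_indicator measurableSet_Iic, Ioi_inter_Iic]
  have e2 : ∫ r in (0 : ℝ)..ρ, r ^ (n - 1) * f r ^ s ≤
      ∫ r in (0 : ℝ)..ρ, C ^ s * D * ((1 + ρ) ^ a * Real.exp (s * ρ / 2)) *
        Real.exp (s / 2 * r) := by
    refine intervalIntegral.integral_mono_on hρ ?_ ?_ fun r hr => ?_
    · refine (Continuous.mul (continuous_pow _)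
        (hfc.rpow_const fun r => Or.inl ?_)).intervalIntegrable _ _
      linarith [hf1 r]
    · exact (by fun_prop : Continuous fun r : ℝ => C ^ s * D *
        ((1 + ρ) ^ a * Real.exp (s * ρ / 2)) * Real.exp (s / 2 * r)).intervalIntegrable _ _
    · have hr0 : 0 ≤ r := hr.1
      have h1r : 0 < 1 + r := by linarith
      have h1ρ : 0 < 1 + ρ := by linarith
      have hfr : 0 ≤ f r := zero_le_one.trans (hf1 r)
      have h1 : r ^ (n - 1) ≤ (1 + r) ^ ((n : ℝ) - 1) := by
        calc r ^ (n - 1) ≤ (1 + r) ^ (n - 1) := by gcongr; linarith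
          _ = _ := by rw [← Real.rpow_natCast, Nat.cast_sub hn]; simp
      have h2 : f r ^ s ≤ C ^ s * ((1 + r) ^ (-(((n : ℝ) - 1) / 2) * s) * Real.exp (s * r)) := by
        have := Real.rpow_le_rpow hfr (hCf r hr0) hs.le
        rwa [Real.mul_rpow hC.le (by positivity), Real.mul_rpow (by positivity) (by positivity),
          ← Real.rpow_mul h1r.le, ← Real.exp_mul, mul_comm r s] at this
      calc r ^ (n - 1) * f r ^ s ≤ (1 + r) ^ ((n : ℝ) - 1) *
            (C ^ s * ((1 + r) ^ (-(((n : ℝ) - 1) / 2) * s) * Real.exp (s * r))) := by gcongr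
        _ = C ^ s * (1 + r) ^ a * Real.exp (s * r) := by
          rw [ha, show ((n : ℝ) - 1) * (1 - s / 2) = ((n : ℝ) - 1) + -(((n : ℝ) - 1) / 2) * s by ring,
            Real.rpow_add h1r]
          ring
        _ ≤ C ^ s * (D * ((1 + ρ) ^ a * Real.exp (s / 2 * (ρ - r)))) * Real.exp (s * r) := by
          gcongr
          exact hDf r ρ hr0 hr.2
        _ = C ^ s * D * (1 + ρ) ^ a * (Real.exp (s / 2 * (ρ - r)) * Real.exp (s * r)) := by ring
        _ = C ^ s * D * (1 + ρ) ^ a * (Real.exp (s * ρ / 2) * Real.exp (s / 2 * r)) := by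
          rw [← Real.exp_add, ← Real.exp_add]
          congr 2
          ring
        _ = _ := by ring
  have e3 : ∫ r in (0 : ℝ)..ρ, Real.exp (s / 2 * r) ≤ 2 / s * Real.exp (s * ρ / 2) := by
    rw [intervalIntegral.integral_comp_mul_left (fun x => Real.exp x) (by positivity : s / 2 ≠ 0)]
    rw [integral_exp, smul_eq_mul, inv_div]
    gcongr
    rw [show s / 2 * ρ = s * ρ / 2 by ring]
    simp
  rw [e1, mul_assoc]
  gcongr
  refine e2.trans ?_
  rw [intervalIntegral.integral_const_mul]
  calc _ ≤ C ^ s * D * ((1 + ρ) ^ a * Real.exp (s * ρ / 2)) * (2 / s * Real.exp (s * ρ / 2)) := by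
        have : 0 < 1 + ρ := by linarith
        gcongr
    _ = C ^ s * D * (2 / s) * ((1 + ρ) ^ a * (Real.exp (s * ρ / 2) * Real.exp (s * ρ / 2))) := by
        ring
    _ = _ := by rw [← Real.exp_add]; congr 3; ring

/-! ### Differential inequalities in integrated form. -/

theorem intervalIntegrable_of_continuousOn_Icc {g : ℝ → ℝ} {t : ℝ} (hg : ContinuousOn g (Icc 0 t))
    {a b : ℝ} (ha : a ∈ Icc 0 t) (hb : b ∈ Icc 0 t) : IntervalIntegrable g volume a b :=
  (hg.mono (uIcc_subset_Icc ha hb)).intervalIntegrable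

theorem hasDerivAt_primitive {g : ℝ → ℝ} {t s : ℝ} (hg : ContinuousOn g (Icc 0 t))
    (hs : s ∈ Ioo 0 t) : HasDerivAt (fun r => ∫ x in (0 : ℝ)..r, g x) (g s) s := by
  have ht : (0 : ℝ) ≤ t := (hs.1.trans hs.2).le
  refine intervalIntegral.integral_hasDerivAt_right
    (intervalIntegrable_of_continuousOn_Icc hg ⟨le_rfl, ht⟩ ⟨hs.1.le, hs.2.le⟩) ?_
    (hg.continuousAt (Icc_mem_nhds hs.1 hs.2))
  exact (hg.mono Ioo_subset_Icc_self).stronglyMeasurableAtFilter isOpen_Ioo s hs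

theorem continuousOn_primitive_Icc {g : ℝ → ℝ} {t : ℝ} (hg : ContinuousOn g (Icc 0 t)) :
    ContinuousOn (fun r => ∫ x in (0 : ℝ)..r, g x) (Icc 0 t) := by
  rcases le_or_gt 0 t with ht | ht
  · have := intervalIntegral.continuousOn_primitive_interval (μ := volume) (f := g) (a := 0) (b := t)
      (by rw [uIcc_of_le ht]; exact hg.integrableOn_Icc)
    rwa [uIcc_of_le ht] at this
  · simp [Icc_eq_empty_of_lt ht]

theorem monotoneOn_primitive {g : ℝ → ℝ} {t : ℝ} (hg : IntegrableOn g (Icc 0 t))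
    (hg0 : ∀ s ∈ Icc 0 t, 0 ≤ g s) : MonotoneOn (fun r => ∫ x in (0 : ℝ)..r, g x) (Icc 0 t) := by
  intro a ha b hb hab
  have hi : ∀ {c d : ℝ}, c ∈ Icc 0 t → d ∈ Icc 0 t → IntervalIntegrable g volume c d :=
    fun hc hd => by
      rw [intervalIntegrable_iff]
      exact hg.mono_set (uIoc_subset_uIcc.trans (uIcc_subset_Icc hc hd))
  have h0 : (0 : ℝ) ∈ Icc 0 t := ⟨le_rfl, ha.1.trans ha.2⟩
  have h := intervalIntegral.integral_add_adjacent_intervals (hi h0 ha) (hi ha hb)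
  have h2 : 0 ≤ ∫ x in a..b, g x :=
    intervalIntegral.integral_nonneg hab fun s hs => hg0 s ⟨ha.1.trans hs.1, hs.2.trans hb.2⟩
  simp only
  linarith

/-- The integrated form of `y' + b y = f + P'` with `P' ≥ 0`. Only monotonicity of `P` is assumed,
because in the application `P` is the primitive of a source that is merely integrable in time. -/
theorem integratingFactor_le {b f y P : ℝ → ℝ} {t : ℝ} (ht : 0 ≤ t)
    (hb : ContinuousOn b (Icc 0 t)) (hb0 : ∀ s ∈ Icc 0 t, 0 ≤ b s)
    (hf : ContinuousOn f (Icc 0 t)) (hy : ContinuousOn y (Icc 0 t))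
    (hP : MonotoneOn P (Icc 0 t))
    (h : ∀ s ∈ Icc 0 t, y s + ∫ r in (0 : ℝ)..s, b r * y r = (∫ r in (0 : ℝ)..s, f r) + P s) :
    P t + ∫ s in (0 : ℝ)..t, Real.exp (∫ r in (0 : ℝ)..s, b r) * f s ≤
      Real.exp (∫ r in (0 : ℝ)..t, b r) * y t := by
  let μ : ℝ → ℝ := fun s => Real.exp (∫ r in (0 : ℝ)..s, b r)
  have hμc : ContinuousOn μ (Icc 0 t) := (continuousOn_primitive_Icc hb).rexp
  have hby : ContinuousOn (fun r => b r * y r) (Icc 0 t) := hb.mul hy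
  have hμf : ContinuousOn (fun r => μ r * f r) (Icc 0 t) := hμc.mul hf
  -- `P` enters frozen at the endpoint `t`, so it is never differentiated; by the hypothesis `h`,
  -- `X' = μ b (P(s) - P(t)) ≤ 0`.
  let X : ℝ → ℝ := fun s => μ s * (∫ r in (0 : ℝ)..s, b r * y r) - μ s * (∫ r in (0 : ℝ)..s, f r)
    + (∫ r in (0 : ℝ)..s, μ r * f r) - μ s * P t
  have hXc : ContinuousOn X (Icc 0 t) :=
    (((hμc.mul (continuousOn_primitive_Icc hby)).sub (hμc.mul (continuousOn_primitive_Icc hf))).add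
      (continuousOn_primitive_Icc hμf)).sub (hμc.mul continuousOn_const)
  have hXd : ∀ s ∈ Ioo 0 t, HasDerivAt X (μ s * b s * (P s - P t)) s := fun s hs => by
    have hμ : HasDerivAt μ (μ s * b s) s := (hasDerivAt_primitive hb hs).exp
    have := (((hμ.mul (hasDerivAt_primitive hby hs)).sub (hμ.mul (hasDerivAt_primitive hf hs))).add
      (hasDerivAt_primitive hμf hs)).sub (hμ.mul_const (P t))
    have h3 : HasDerivAt X _ s := this
    convert h3 using 1
    have := h s ⟨hs.1.le, hs.2.le⟩
    linear_combination (- μ s * b s) * this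
  have hanti : AntitoneOn X (Icc 0 t) := by
    refine antitoneOn_of_deriv_nonpos (convex_Icc 0 t) hXc ?_ ?_
    · rw [interior_Icc]
      exact fun s hs => (hXd s hs).differentiableAt.differentiableWithinAt
    · rw [interior_Icc]
      intro s hs
      rw [(hXd s hs).deriv]
      have h1 := hP ⟨hs.1.le, hs.2.le⟩ ⟨ht, le_rfl⟩ hs.2.le
      have h2 := hb0 s ⟨hs.1.le, hs.2.le⟩
      have h3 : 0 ≤ μ s := (Real.exp_pos _).le
      exact mul_nonpos_of_nonneg_of_nonpos (mul_nonneg h3 h2) (by linarith)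
  have h1 := hanti ⟨le_rfl, ht⟩ ⟨ht, le_rfl⟩ ht
  have h0 : X 0 = - P t := by simp [X, μ]
  have h2 := h t ⟨ht, le_rfl⟩
  rw [h0] at h1
  change P t + ∫ s in (0 : ℝ)..t, μ s * f s ≤ μ t * y t
  have h3 : y t = (∫ r in (0 : ℝ)..t, f r) + P t - ∫ r in (0 : ℝ)..t, b r * y r := by linarith
  rw [h3]
  simp only [X] at h1
  linarith

theorem dampedPrimitive_le {b y P : ℝ → ℝ} {t : ℝ} (ht : 0 ≤ t)
    (hb : ContinuousOn b (Icc 0 t)) (hb0 : ∀ s ∈ Icc 0 t, 0 ≤ b s)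
    (hy : ContinuousOn y (Icc 0 t)) (hP : MonotoneOn P (Icc 0 t))
    (h : ∀ s ∈ Icc 0 t, y s + ∫ r in (0 : ℝ)..s, b r * y r = P s) :
    P t ≤ Real.exp (∫ r in (0 : ℝ)..t, b r) * y t := by
  have := integratingFactor_le (f := fun _ => 0) ht hb hb0 continuousOn_const hy hP
    (fun s hs => by simpa using h s hs)
  simpa using this

/-- A reverse Grönwall inequality: `e^(-s) (A + ∫ X)` is nondecreasing. -/
theorem le_of_add_integral_le {A : ℝ} {X : ℝ → ℝ} {t : ℝ} (ht : 0 ≤ t)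
    (hX : ContinuousOn X (Icc 0 t))
    (h : ∀ s ∈ Icc 0 t, A + ∫ r in (0 : ℝ)..s, X r ≤ X s) : A * Real.exp t ≤ X t := by
  let G : ℝ → ℝ := fun s => Real.exp (-s) * (A + ∫ r in (0 : ℝ)..s, X r)
  have hd : ∀ s ∈ Ioo 0 t, HasDerivAt G
      (Real.exp (-s) * (X s - (A + ∫ r in (0 : ℝ)..s, X r))) s := fun s hs => by
    have := ((hasDerivAt_id s).neg.exp).mul ((hasDerivAt_primitive hX hs).const_add A)
    have h3 : HasDerivAt G _ s := this
    convert h3 using 1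
    simp
    ring
  have hm : MonotoneOn G (Icc 0 t) := by
    refine monotoneOn_of_deriv_nonneg (convex_Icc 0 t) ?_ ?_ ?_
    · exact (by fun_prop : Continuous fun s : ℝ => Real.exp (-s)).continuousOn.mul
        (continuousOn_const.add (continuousOn_primitive_Icc hX))
    · rw [interior_Icc]
      exact fun s hs => (hd s hs).differentiableAt.differentiableWithinAt
    · rw [interior_Icc]
      intro s hs
      rw [(hd s hs).deriv]
      exact mul_nonneg (Real.exp_pos _).le (by linarith [h s ⟨hs.1.le, hs.2.le⟩])
  have h1 := hm ⟨le_rfl, ht⟩ ⟨ht, le_rfl⟩ ht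
  have h2 : G 0 = A := by simp [G]
  rw [h2] at h1
  simp only [G, Real.exp_neg] at h1
  rw [le_inv_mul_iff₀ (Real.exp_pos t), mul_comm] at h1
  exact h1.trans (h t ⟨ht, le_rfl⟩)

/-- Positivity for `W'' + b W' = W + N` with `N ≥ 0` and nontrivial nonnegative data, in integrated
form. -/
theorem pos_of_volterra {b W y P : ℝ → ℝ} {t : ℝ} (ht : 0 ≤ t)
    (hb : ContinuousOn b (Icc 0 t)) (hb0 : ∀ s ∈ Icc 0 t, 0 ≤ b s)
    (hW : ∀ s ∈ Icc 0 t, HasDerivWithinAt W (y s) (Icc 0 t) s)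
    (hy : ContinuousOn y (Icc 0 t)) (hP : MonotoneOn P (Icc 0 t))
    (h : ∀ s ∈ Icc 0 t, y s + ∫ r in (0 : ℝ)..s, b r * y r = (∫ r in (0 : ℝ)..s, W r) + P s)
    (hW0 : 0 ≤ W 0) (hP0 : 0 ≤ P 0) (hpos : 0 < W 0 + P 0) {s : ℝ} (hs : s ∈ Ioc 0 t) :
    0 < W s := by
  have hWc : ContinuousOn W (Icc 0 t) := fun s hs => (hW s hs).continuousWithinAt
  have hWd : ∀ s ∈ Ioo 0 t, HasDerivAt W (y s) s := fun s hs =>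
    (hW s ⟨hs.1.le, hs.2.le⟩).hasDerivAt (Icc_mem_nhds hs.1 hs.2)
  have h0t : (0 : ℝ) ∈ Icc 0 t := ⟨le_rfl, ht⟩
  have ht0 : 0 < t := hs.1.trans_le hs.2
  -- If `W 0 = 0`, then `y 0 = P 0 > 0` and `W` starts by strictly increasing; if `W 0 > 0`,
  -- continuity suffices.
  obtain ⟨δ, hδ, hδW⟩ : ∃ δ > 0, ∀ s ∈ Ioc 0 t, s ≤ δ → 0 < W s := by
    rcases hW0.eq_or_lt with h0 | h0
    · have hy0 : 0 < y 0 := by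
        have := h 0 h0t
        simp only [intervalIntegral.integral_same, add_zero, zero_add] at this
        rw [this]; linarith
      have := (hy 0 h0t).eventually (lt_mem_nhds hy0)
      rw [Filter.Eventually, Metric.mem_nhdsWithin_iff] at this
      obtain ⟨δ, hδ, H⟩ := this
      refine ⟨δ / 2, half_pos hδ, fun s hs hsδ => ?_⟩
      have hsm : StrictMonoOn W (Icc 0 s) := by
        refine strictMonoOn_of_deriv_pos (convex_Icc 0 s) (hWc.mono (Icc_subset_Icc_right hs.2)) ?_
        rw [interior_Icc]
        intro r hr
        rw [(hWd r ⟨hr.1, hr.2.trans_le hs.2⟩).deriv]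
        refine H ⟨?_, hr.1.le, hr.2.le.trans hs.2⟩
        rw [Metric.mem_ball, Real.dist_eq, sub_zero, abs_of_pos hr.1]
        linarith [hr.2]
      have := hsm ⟨le_rfl, hs.1.le⟩ ⟨hs.1.le, le_rfl⟩ hs.1
      linarith
    · have := (hWc 0 h0t).eventually (lt_mem_nhds h0)
      rw [Filter.Eventually, Metric.mem_nhdsWithin_iff] at this
      obtain ⟨δ, hδ, H⟩ := this
      refine ⟨δ / 2, half_pos hδ, fun s hs hsδ => H ⟨?_, hs.1.le, hs.2⟩⟩
      rw [Metric.mem_ball, Real.dist_eq, sub_zero, abs_of_pos hs.1]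
      linarith
  by_contra hneg
  have hδs : δ < s := by
    by_contra hc
    exact hneg (hδW s hs (not_lt.1 hc))
  have hSsub : Icc δ s ⊆ Icc 0 t := Icc_subset_Icc hδ.le hs.2
  have hScl : IsCompact {r | r ∈ Icc δ s ∧ W r ∈ Iic 0} := by
    refine isCompact_Icc.of_isClosed_subset ?_ fun r hr => hr.1
    exact (hWc.mono hSsub).preimage_isClosed_of_isClosed isClosed_Icc isClosed_Iic
  -- Before the first time `τ ≥ δ` with `W ≤ 0`, nonnegativity of `W` forces `W' = y ≥ 0`, hence `W
  -- τ ≥ W δ > 0`.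
  obtain ⟨τ, ⟨hτ, hWτ⟩, hmin⟩ := hScl.exists_isLeast ⟨s, ⟨hδs.le, le_rfl⟩, not_lt.1 hneg⟩
  have hτt : τ ≤ t := hτ.2.trans hs.2
  have hδτ : δ ≤ τ := hτ.1
  have hWnn : ∀ r, 0 ≤ r → r < τ → 0 ≤ W r := fun r hr hrτ => by
    rcases hr.eq_or_lt with rfl | hr
    · exact hW0
    rcases le_total r δ with h1 | h1
    · exact (hδW r ⟨hr, by linarith⟩ h1).le
    · by_contra hc
      exact absurd (hmin ⟨⟨h1, hrτ.le.trans hτ.2⟩, (not_le.1 hc).le⟩) (not_le.2 hrτ)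
  have hynn : ∀ r, 0 ≤ r → r < τ → 0 ≤ y r := fun r hr hrτ => by
    have hsub : Icc 0 r ⊆ Icc 0 t := Icc_subset_Icc_right (by linarith)
    have hmon : MonotoneOn (fun s => (∫ r in (0 : ℝ)..s, W r) + P s) (Icc 0 r) :=
      (monotoneOn_primitive ((hWc.mono hsub).integrableOn_Icc)
        fun x hx => hWnn x hx.1 (hx.2.trans_lt hrτ)).add (hP.mono hsub)
    have h1 := dampedPrimitive_le hr (hb.mono hsub) (fun x hx => hb0 x (hsub hx)) (hy.mono hsub)
      hmon (fun x hx => h x (hsub hx))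
    have h2 := hmon ⟨le_rfl, hr⟩ ⟨hr, le_rfl⟩ hr
    simp only [intervalIntegral.integral_same, zero_add] at h2
    by_contra hc
    have := mul_neg_of_pos_of_neg (Real.exp_pos (∫ x in (0 : ℝ)..r, b x)) (not_le.1 hc)
    linarith
  have hWm : MonotoneOn W (Icc 0 τ) := by
    refine monotoneOn_of_deriv_nonneg (convex_Icc 0 τ) (hWc.mono (Icc_subset_Icc_right hτt)) ?_ ?_
    · rw [interior_Icc]
      exact fun r hr => (hWd r ⟨hr.1, hr.2.trans_le hτt⟩).differentiableAt.differentiableWithinAt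
    · rw [interior_Icc]
      intro r hr
      rw [(hWd r ⟨hr.1, hr.2.trans_le hτt⟩).deriv]
      exact hynn r hr.1.le hr.2
  have h1 := hWm ⟨hδ.le, hδτ⟩ ⟨hδ.le.trans hδτ, le_rfl⟩ hδτ
  have h2 := hδW δ ⟨hδ, by linarith⟩ le_rfl
  have h3 : W τ ≤ 0 := hWτ
  linarith

/-- Exponential growth for `W'' + b W' = W + N` with `N ≥ 0`, in integrated form. -/
theorem exp_le_of_volterra {b W y P : ℝ → ℝ} {t M : ℝ} (ht : 1 ≤ t)
    (hb : ContinuousOn b (Icc 0 t)) (hb0 : ∀ s ∈ Icc 0 t, 0 ≤ b s)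
    (hM : ∀ s ∈ Icc 0 t, Real.exp (∫ r in (0 : ℝ)..s, b r) ≤ M)
    (hW : ∀ s ∈ Icc 0 t, HasDerivWithinAt W (y s) (Icc 0 t) s)
    (hy : ContinuousOn y (Icc 0 t)) (hP : MonotoneOn P (Icc 0 t))
    (h : ∀ s ∈ Icc 0 t, y s + ∫ r in (0 : ℝ)..s, b r * y r = (∫ r in (0 : ℝ)..s, W r) + P s)
    (hW0 : 0 ≤ W 0) (hP0 : 0 ≤ P 0) (hpos : 0 < W 0 + P 0) :
    (W 0 + P 0) / (4 * M) * Real.exp t ≤ W t := by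
  have ht0 : 0 ≤ t := by linarith
  have h0t : (0 : ℝ) ∈ Icc 0 t := ⟨le_rfl, ht0⟩
  have hM0 : 0 < M := (Real.exp_pos _).trans_le (hM 0 h0t)
  obtain ⟨A, hA⟩ : ∃ A, A = W 0 + P 0 := ⟨_, rfl⟩
  rw [← hA] at hpos ⊢
  have hWc : ContinuousOn W (Icc 0 t) := fun s hs => (hW s hs).continuousWithinAt
  have hWd : ∀ s ∈ Ioo 0 t, HasDerivAt W (y s) s := fun s hs =>
    (hW s ⟨hs.1.le, hs.2.le⟩).hasDerivAt (Icc_mem_nhds hs.1 hs.2)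
  have hWnn : ∀ s ∈ Icc 0 t, 0 ≤ W s := fun s hs => by
    rcases hs.1.eq_or_lt with rfl | h0
    · exact hW0
    · exact (pos_of_volterra ht0 hb hb0 hW hy hP h hW0 hP0 (hA ▸ hpos) ⟨h0, hs.2⟩).le
  have hii : ∀ {g : ℝ → ℝ}, ContinuousOn g (Icc 0 t) → ∀ {s}, s ∈ Icc 0 t →
      IntervalIntegrable g volume 0 s := fun hg s hs =>
    intervalIntegrable_of_continuousOn_Icc hg h0t hs
  have hWint : ∀ s ∈ Icc 0 t, W s = W 0 + ∫ r in (0 : ℝ)..s, y r := fun s hs => by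
    have := intervalIntegral.integral_eq_sub_of_hasDerivAt_of_le hs.1
      (hWc.mono (Icc_subset_Icc_right hs.2))
      (fun r hr => hWd r ⟨hr.1, hr.2.trans_le hs.2⟩) (hii hy hs)
    linarith
  -- The sum `Z = W + W'` obeys the first-order equation `Z' + bZ = Z + bW + P'` with `bW ≥ 0`, so
  -- the integrating factor and reverse Grönwall give `Z ≥ (A/M) e^s`.
  have hZc : ContinuousOn (fun s => W s + y s) (Icc 0 t) := hWc.add hy
  have hZ : ∀ s ∈ Icc 0 t, A + ∫ r in (0 : ℝ)..s,
      Real.exp (∫ x in (0 : ℝ)..r, b x) * (W r + y r) ≤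
        Real.exp (∫ x in (0 : ℝ)..s, b x) * (W s + y s) := fun s hs => by
    have hsub : Icc 0 s ⊆ Icc 0 t := Icc_subset_Icc_right hs.2
    have hmon : MonotoneOn (fun s => W 0 + P s + ∫ r in (0 : ℝ)..s, b r * W r) (Icc 0 t) :=
      (monotoneOn_const.add hP).add (monotoneOn_primitive ((hb.mul hWc).integrableOn_Icc)
        fun r hr => mul_nonneg (hb0 r hr) (hWnn r hr))
    have h1 := integratingFactor_le (P := fun s => W 0 + P s + ∫ r in (0 : ℝ)..s, b r * W r)
      (y := fun s => W s + y s) (f := fun s => W s + y s) hs.1 (hb.mono hsub)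
      (fun x hx => hb0 x (hsub hx)) (hZc.mono hsub) (hZc.mono hsub) (hmon.mono hsub)
      (fun r hr => by
        have hr' := hsub hr
        simp only [mul_add]
        have e1 := intervalIntegral.integral_add (hii (hb.mul hWc) hr') (hii (hb.mul hy) hr')
        have e2 := intervalIntegral.integral_add (hii hWc hr') (hii hy hr')
        simp only [Pi.mul_apply] at e1
        linarith [h r hr', hWint r hr'])
    have h2 := hmon h0t hs hs.1
    simp only [intervalIntegral.integral_same, add_zero] at h2
    linarith
  have hμc : ContinuousOn (fun s => Real.exp (∫ x in (0 : ℝ)..s, b x)) (Icc 0 t) :=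
    (continuousOn_primitive_Icc hb).rexp
  have hZexp : ∀ s ∈ Icc 0 t, A / M * Real.exp s ≤ W s + y s := fun s hs => by
    have hsub : Icc 0 s ⊆ Icc 0 t := Icc_subset_Icc_right hs.2
    have h1 := le_of_add_integral_le hs.1 ((hμc.mul hZc).mono hsub) (fun r hr => hZ r (hsub hr))
    simp only [Pi.mul_apply] at h1
    have h2 : 0 ≤ W s + y s := by
      by_contra hc
      have := mul_neg_of_pos_of_neg (Real.exp_pos (∫ x in (0 : ℝ)..s, b x)) (not_le.1 hc)
      have h3 : 0 < A * Real.exp s := by positivity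
      linarith
    have h4 := h1.trans (mul_le_mul_of_nonneg_right (hM s hs) h2)
    rw [div_mul_eq_mul_div, div_le_iff₀ hM0]
    linarith
  -- The bound on `Z` is integrated through `(e^s W)' = e^s Z ≥ (A/M) e^(2s)`.
  have hE : MonotoneOn (fun s => Real.exp s * W s - A / (2 * M) * Real.exp (2 * s)) (Icc 0 t) := by
    have hd : ∀ s ∈ Ioo 0 t, HasDerivAt (fun s => Real.exp s * W s - A / (2 * M) * Real.exp (2 * s))
        (Real.exp s * (W s + y s - A / M * Real.exp s)) s := fun s hs => by
      have := ((Real.hasDerivAt_exp s).mul (hWd s hs)).sub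
        ((((hasDerivAt_id s).const_mul 2).exp).const_mul (A / (2 * M)))
      have h3 : HasDerivAt (fun s => Real.exp s * W s - A / (2 * M) * Real.exp (2 * s)) _ s := this
      convert h3 using 1
      simp only [id, two_mul s, Real.exp_add]
      field_simp
    refine monotoneOn_of_deriv_nonneg (convex_Icc 0 t) ?_ ?_ ?_
    · exact (Real.continuous_exp.continuousOn.mul hWc).sub (by fun_prop)
    · rw [interior_Icc]
      exact fun s hs => (hd s hs).differentiableAt.differentiableWithinAt
    · rw [interior_Icc]
      intro s hs
      rw [(hd s hs).deriv]
      exact mul_nonneg (Real.exp_pos _).le (by linarith [hZexp s ⟨hs.1.le, hs.2.le⟩])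
  have h1 := hE h0t ⟨ht0, le_rfl⟩ ht0
  simp only [Real.exp_zero, one_mul, mul_zero, mul_one] at h1
  -- Since `t ≥ 1`, half of `e^(2t)` absorbs the boundary term at time `0`; this turns `2M` into
  -- `4M`.
  have h2 : (2 : ℝ) ≤ Real.exp t * Real.exp t := by
    have := Real.add_one_le_exp t
    nlinarith
  have h3 : Real.exp (2 * t) = Real.exp t * Real.exp t := by rw [two_mul, Real.exp_add]
  rw [h3] at h1
  have h4 : A / (2 * M) = 2 * (A / (4 * M)) := by field_simp; norm_num
  have h5 : 0 < A / (4 * M) := by positivity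
  rw [h4] at h1
  have h6 : Real.exp t * (A / (4 * M) * Real.exp t) ≤ Real.exp t * W t := by nlinarith
  exact le_of_mul_le_mul_left h6 (Real.exp_pos t)

/-! ### Testing the weak equation with functions of `x` alone. -/

theorem integral_mul_eq_inner {n : ℕ} {g : Space n → ℝ} (hg : MemLp g 2) (f : L2 n) :
    ∫ x, f x * g x = ⟪hg.toLp g, f⟫_ℝ := by
  rw [MeasureTheory.L2.inner_def]
  refine integral_congr_ae ?_
  filter_upwards [hg.coeFn_toLp] with x hx
  simp [hx]

theorem hasDerivWithinAt_pairing {n : ℕ} {g : Space n → ℝ} (hg : MemLp g 2) {u : ℝ → L2 n}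
    {u' : L2 n} {S : Set ℝ} {t : ℝ} (hu : HasDerivWithinAt u u' S t) :
    HasDerivWithinAt (fun s => ∫ x, u s x * g x) (∫ x, u' x * g x) S t := by
  simp only [integral_mul_eq_inner hg]
  exact (innerSL ℝ (hg.toLp g)).hasFDerivAt.comp_hasDerivWithinAt t hu

theorem continuousOn_pairing {n : ℕ} {g : Space n → ℝ} (hg : MemLp g 2) {u : ℝ → L2 n}
    {S : Set ℝ} (hu : ContinuousOn u S) : ContinuousOn (fun s => ∫ x, u s x * g x) S := by
  simp only [integral_mul_eq_inner hg]
  exact (innerSL ℝ (hg.toLp g)).continuous.comp_continuousOn hu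

theorem mem_timeInterval_of_le {T : ℝ≥0∞} {s t : ℝ} (ht : t ∈ timeInterval T) (hs : 0 ≤ s)
    (hst : s ≤ t) : s ∈ timeInterval T :=
  ⟨hs, (ENNReal.ofReal_le_ofReal hst).trans_lt ht.2⟩

theorem Icc_subset_timeInterval {T : ℝ≥0∞} {t : ℝ} (ht : t ∈ timeInterval T) :
    Icc 0 t ⊆ timeInterval T := fun _ hs => mem_timeInterval_of_le ht hs.1 hs.2

theorem integral_inner_gradient {n : ℕ} {f : L2 n} {F : L2Vec n} (h : HasWeakGradient f F)
    {g : Space n → ℝ} (hg : ContDiff ℝ ∞ g) (hgc : HasCompactSupport g) :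
    ∫ x, ⟪F x, gradient g x⟫_ℝ = - ∫ x, f x * lap g x := by
  let e : Fin n → Space n := fun i => EuclideanSpace.single i 1
  have hd : ∀ i, ContDiff ℝ ∞ (fun x => fderiv ℝ g x (e i)) := fun i =>
    (hg.fderiv_right (m := ∞) (by simp)).clm_apply contDiff_const
  have hdc : ∀ i, HasCompactSupport (fun x => fderiv ℝ g x (e i)) := fun i =>
    hgc.fderiv_apply ℝ (e i)
  have hdd : ∀ i, Continuous (fun x => fderiv ℝ (fun y => fderiv ℝ g y (e i)) x (e i)) := fun i =>
    (((hd i).fderiv_right (m := ∞) (by simp)).clm_apply contDiff_const).continuous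
  have hddc : ∀ i, HasCompactSupport
      (fun x => fderiv ℝ (fun y => fderiv ℝ g y (e i)) x (e i)) := fun i =>
    (hdc i).fderiv_apply ℝ (e i)
  have hFi : ∀ i, MemLp (fun x => ⟪F x, e i⟫_ℝ) 2 := fun i =>
    (Lp.memLp F).inner_const (e i)
  have e1 : ∀ x, ⟪F x, gradient g x⟫_ℝ = ∑ i, ⟪F x, e i⟫_ℝ * fderiv ℝ g x (e i) := fun x => by
    have h1 : F x = ∑ i, ⟪F x, e i⟫_ℝ • e i := by
      have := (EuclideanSpace.basisFun (Fin n) ℝ).sum_repr (F x)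
      simp only [EuclideanSpace.basisFun_repr, EuclideanSpace.basisFun_apply] at this
      simpa [e, EuclideanSpace.inner_single_right] using this.symm
    rw [real_inner_comm]
    unfold gradient
    rw [InnerProductSpace.toDual_symm_apply]
    conv_lhs => rw [h1]
    simp
  simp_rw [e1]
  have hi1 : ∀ i ∈ Finset.univ, Integrable fun x => ⟪F x, e i⟫_ℝ * fderiv ℝ g x (e i) :=
    fun i _ => (hFi i).integrable_mul ((hd i).continuous.memLp_of_hasCompactSupport (p := 2) (hdc i))
  have hi2 : ∀ i ∈ Finset.univ, Integrable fun x =>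
      f x * fderiv ℝ (fun y => fderiv ℝ g y (e i)) x (e i) :=
    fun i _ => (Lp.memLp f).integrable_mul ((hdd i).memLp_of_hasCompactSupport (p := 2) (hddc i))
  rw [integral_finsetSum _ hi1]
  simp only [lap, Finset.mul_sum]
  rw [integral_finsetSum _ hi2, ← Finset.sum_neg_distrib]
  refine Finset.sum_congr rfl fun i _ => ?_
  have := h _ (hd i) (hdc i) (e i)
  linarith

theorem WeakWaveEquation.spatial {n : ℕ} {b : ℝ → ℝ} {r ε : ℝ} {f₁ : Space n → ℝ} {T : ℝ≥0∞}
    {u ut v : ℝ → L2 n} {Du : ℝ → L2Vec n} (h : WeakWaveEquation b r ε f₁ T ut Du v)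
    (hgrad : ∀ t ∈ timeInterval T, HasWeakGradient (u t) (Du t)) {g : Space n → ℝ}
    (hg : ContDiff ℝ ∞ g) (hgc : HasCompactSupport g) {t : ℝ} (ht : t ∈ timeInterval T) :
    (∫ x, ut t x * g x) + (∫ s in (0 : ℝ)..t, b s * ∫ x, ut s x * g x) =
      (∫ s in (0 : ℝ)..t, ∫ x, u s x * lap g x) +
        (ε * (∫ x, f₁ x * g x) + ∫ s in (0 : ℝ)..t, ∫ x, |v s x| ^ r * g x) := by
  -- The test function is `χ(s) g(x)`; room between `t` and `T` allows a time cutoff equal to `1`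
  -- near `[0, t]`, so the term with `φ_s` vanishes.
  obtain ⟨t', ht'0, htt', ht'T⟩ := ENNReal.lt_iff_exists_real_btwn.1 ht.2
  have htt : t < t' := (ENNReal.ofReal_lt_ofReal_iff_of_nonneg ht.1).1 htt'
  have ht0 := ht.1
  let χ : ContDiffBump (0 : ℝ) := ⟨(t + t') / 2, t', by linarith, by linarith⟩
  have hball : ∀ s ∈ Icc 0 t, s ∈ Metric.ball (0 : ℝ) χ.rIn := fun s hs => by
    rw [Metric.mem_ball, Real.dist_eq, sub_zero, abs_of_nonneg hs.1]
    change s < (t + t') / 2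
    linarith [hs.2]
  have hχ1 : ∀ s ∈ Icc 0 t, χ s = 1 := fun s hs =>
    χ.one_of_mem_closedBall (Metric.ball_subset_closedBall (hball s hs))
  have hχd : ∀ s ∈ Icc 0 t, ∀ c : ℝ, deriv (fun τ => χ τ * c) s = 0 := fun s hs c => by
    have h1 : (fun τ => χ τ * c) =ᶠ[nhds s] fun _ => c := by
      filter_upwards [χ.eventuallyEq_one_of_mem_ball (hball s hs)] with τ hτ
      simp [hτ]
    rw [h1.deriv_eq, deriv_const]
  have hsupp : ∀ z : ℝ × Space n, χ z.1 * g z.2 ≠ 0 →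
      z ∈ Metric.closedBall (0 : ℝ) t' ×ˢ tsupport g := fun z hz => by
    refine ⟨?_, subset_tsupport _ (right_ne_zero_of_mul hz)⟩
    have := χ.support_eq ▸ (Function.mem_support.2 (left_ne_zero_of_mul hz))
    exact Metric.ball_subset_closedBall this
  have hcpt : IsCompact (Metric.closedBall (0 : ℝ) t' ×ˢ tsupport g) :=
    (isCompact_closedBall _ _).prod hgc
  have htest : IsTestFunction T fun z : ℝ × Space n => χ z.1 * g z.2 := by
    refine ⟨(χ.contDiff.comp contDiff_fst).mul (hg.comp contDiff_snd),
      HasCompactSupport.intro hcpt fun z hz => ?_, fun z hz => ?_⟩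
    · by_contra hc
      exact hz (hsupp z hc)
    · have : tsupport (fun z : ℝ × Space n => χ z.1 * g z.2) ⊆ _ :=
        closure_minimal (fun z hz => hsupp z hz) hcpt.isClosed
      have h1 := (this hz).1
      rw [Metric.mem_closedBall, Real.dist_eq, sub_zero] at h1
      exact (ENNReal.ofReal_le_ofReal ((le_abs_self _).trans h1)).trans_lt ht'T
  have key := h _ htest t ht
  have h0 : (0 : ℝ) ∈ Icc 0 t := ⟨le_rfl, ht.1⟩
  simp only [hχ1 t ⟨ht.1, le_rfl⟩, hχ1 0 h0, one_mul] at key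
  have hcongr : ∀ {F G : ℝ → ℝ}, (∀ s ∈ Icc 0 t, F s = G s) →
      ∫ s in (0 : ℝ)..t, F s = ∫ s in (0 : ℝ)..t, G s := fun hFG =>
    intervalIntegral.integral_congr fun s hs => hFG s (by rwa [uIcc_of_le ht.1] at hs)
  rw [hcongr (F := fun s => ∫ x, ut s x * deriv (fun τ => χ τ * g x) s) (G := fun _ => 0) fun s hs => by simp [hχd s hs]] at key
  rw [hcongr (F := fun s => ∫ x, ⟪Du s x, gradient (fun y => χ s * g y) x⟫_ℝ)
    (G := fun s => - ∫ x, u s x * lap g x) fun s hs => by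
    simp only [hχ1 s hs, one_mul]
    exact integral_inner_gradient (hgrad s (Icc_subset_timeInterval ht hs)) hg hgc] at key
  rw [hcongr (F := fun s => ∫ x, b s * ut s x * (χ s * g x)) (G := fun s => b s * ∫ x, ut s x * g x) fun s hs => by
    simp only [hχ1 s hs, one_mul, mul_assoc]
    rw [integral_const_mul]] at key
  rw [hcongr (F := fun s => ∫ x, |v s x| ^ r * (χ s * g x))
    (G := fun s => ∫ x, |v s x| ^ r * g x) fun s hs => by simp only [hχ1 s hs, one_mul]] at key
  rw [intervalIntegral.integral_neg, intervalIntegral.integral_zero] at key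
  simp only [mul_assoc] at key
  rw [integral_const_mul] at key
  linarith

/-! ### Measurability and integrability in time of the source. -/

/-- Continuity in `L²` does not make this function of `s` continuous, but it is lower
semicontinuous: `L²` convergence yields an a.e. convergent subsequence, and Fatou's lemma shows that
sublevel sets are closed. -/
theorem measurable_lintegral_rpow {n : ℕ} {v : ℝ → L2 n} (hv : Continuous v) {r : ℝ} (hr : 0 ≤ r)
    {w : Space n → ℝ≥0∞} (hw : Measurable w) (hw' : ∀ x, w x ≠ ⊤) :
    Measurable fun s => ∫⁻ x, ENNReal.ofReal (|v s x| ^ r) * w x := by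
  have hm : ∀ s, Measurable fun x => ENNReal.ofReal (|v s x| ^ r) * w x := fun s =>
    (ENNReal.measurable_ofReal.comp
      ((Lp.stronglyMeasurable (v s)).measurable.abs.pow_const r)).mul hw
  refine measurable_of_Iic fun c => IsClosed.measurableSet (IsSeqClosed.isClosed ?_)
  intro s s₀ hs hs₀
  have h1 : Filter.Tendsto (fun k => v (s k)) Filter.atTop (nhds (v s₀)) :=
    (hv.tendsto s₀).comp hs₀
  obtain ⟨φ, hφ, hae⟩ := (tendstoInMeasure_of_tendsto_Lp h1).exists_seq_tendsto_ae
  change _ ≤ c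
  calc ∫⁻ x, ENNReal.ofReal (|v s₀ x| ^ r) * w x
      ≤ ∫⁻ x, Filter.liminf (fun k => ENNReal.ofReal (|v (s (φ k)) x| ^ r) * w x)
          Filter.atTop := by
        refine lintegral_mono_ae ?_
        filter_upwards [hae] with x hx
        have h2 := ENNReal.Tendsto.mul_const (b := w x) (ENNReal.tendsto_ofReal
          (hx.abs.rpow_const (Or.inr hr))) (Or.inr (hw' x))
        exact h2.liminf_eq.ge
    _ ≤ Filter.liminf (fun k => ∫⁻ x, ENNReal.ofReal (|v (s (φ k)) x| ^ r) * w x)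
          Filter.atTop := lintegral_liminf_le fun k => hm _
    _ ≤ c := by
        refine Filter.liminf_le_of_le (by isBoundedDefault) fun b hb => ?_
        obtain ⟨k, hk⟩ := hb.exists
        exact hk.trans (hs (φ k))

theorem aemeasurable_lintegral_rpow {n : ℕ} {v : ℝ → L2 n} {t : ℝ}
    (hv : ContinuousOn v (Icc 0 t)) {r : ℝ} (hr : 0 ≤ r)
    {w : Space n → ℝ≥0∞} (hw : Measurable w) (hw' : ∀ x, w x ≠ ⊤) :
    AEMeasurable (fun s => ∫⁻ x, ENNReal.ofReal (|v s x| ^ r) * w x)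
      (volume.restrict (Icc 0 t)) := by
  rcases lt_or_ge t 0 with ht | ht
  · simp [Icc_eq_empty_of_lt ht]
  · refine ⟨_, measurable_lintegral_rpow
      (v := Set.IccExtend ht ((Icc 0 t).domRestrict v)) ?_ hr hw hw', ?_⟩
    · exact (continuousOn_iff_continuous_domRestrict.1 hv).Icc_extend'
    · filter_upwards [ae_restrict_mem measurableSet_Icc] with s hs
      rw [IccExtend_of_mem _ _ hs]
      rfl

theorem ae_lintegral_rpow_lt_top {n : ℕ} {v : ℝ → L2 n} {t : ℝ}
    (hv : ContinuousOn v (Icc 0 t)) {r : ℝ} (hr : 0 ≤ r) {K : Set (Space n)} (hK : IsCompact K)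
    (hfin : ∫⁻ s in Icc 0 t, ∫⁻ x in K, ENNReal.ofReal (|v s x| ^ r) < ⊤) :
    ∀ᵐ s ∂(volume.restrict (Icc 0 t)), ∫⁻ x in K, ENNReal.ofReal (|v s x| ^ r) < ⊤ := by
  refine ae_lt_top' ?_ hfin.ne
  have := aemeasurable_lintegral_rpow hv hr (w := K.indicator 1)
    (measurable_one.indicator hK.measurableSet) fun x => by by_cases h : x ∈ K <;> simp [h]
  refine this.congr (Filter.Eventually.of_forall fun s => ?_)
  change _ = ∫⁻ x in K, ENNReal.ofReal (|v s x| ^ r)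
  rw [← lintegral_indicator hK.measurableSet]
  refine lintegral_congr fun x => ?_
  by_cases h : x ∈ K <;> simp [h]

theorem integrableOn_integral_rpow {n : ℕ} {v : ℝ → L2 n} {t : ℝ}
    (hv : ContinuousOn v (Icc 0 t)) {r : ℝ} (hr : 0 ≤ r)
    (hfin : ∀ K : Set (Space n), IsCompact K →
      ∫⁻ s in Icc 0 t, ∫⁻ x in K, ENNReal.ofReal (|v s x| ^ r) < ⊤)
    {g : Space n → ℝ} (hg : Continuous g) (hgc : HasCompactSupport g) (hg0 : ∀ x, 0 ≤ g x) :
    IntegrableOn (fun s => ∫ x, |v s x| ^ r * g x) (Icc 0 t) := by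
  have hw : Measurable fun x => ENNReal.ofReal (g x) := hg.measurable.ennreal_ofReal
  have e1 : ∀ s, ∫ x, |v s x| ^ r * g x =
      (∫⁻ x, ENNReal.ofReal (|v s x| ^ r) * ENNReal.ofReal (g x)).toReal := fun s => by
    rw [integral_eq_lintegral_of_nonneg_ae]
    · congr 1
      exact lintegral_congr fun x => ENNReal.ofReal_mul (by positivity)
    · exact Filter.Eventually.of_forall fun x => mul_nonneg (by positivity) (hg0 x)
    · exact (((Lp.stronglyMeasurable (v s)).measurable.abs.pow_const r).mul
        hg.measurable).aestronglyMeasurable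
  simp_rw [e1]
  obtain ⟨C, hC⟩ := hg.bounded_above_of_compact_support hgc
  refine integrable_toReal_of_lintegral_ne_top
    (aemeasurable_lintegral_rpow hv hr hw fun x => ENNReal.ofReal_ne_top) (ne_of_lt ?_)
  calc ∫⁻ s in Icc 0 t, ∫⁻ x, ENNReal.ofReal (|v s x| ^ r) * ENNReal.ofReal (g x)
      ≤ ∫⁻ s in Icc 0 t, ENNReal.ofReal C *
          ∫⁻ x in tsupport g, ENNReal.ofReal (|v s x| ^ r) := by
        refine lintegral_mono fun s => ?_
        rw [← lintegral_const_mul' _ _ ENNReal.ofReal_ne_top,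
          ← lintegral_indicator hgc.isCompact.measurableSet]
        refine lintegral_mono fun x => ?_
        by_cases h : x ∈ tsupport g
        · simp only [indicator_of_mem h]
          rw [mul_comm]
          gcongr
          exact (le_abs_self _).trans (hC x)
        · simp [image_eq_zero_of_notMem_tsupport h]
    _ = ENNReal.ofReal C * ∫⁻ s in Icc 0 t, ∫⁻ x in tsupport g, ENNReal.ofReal (|v s x| ^ r) :=
        lintegral_const_mul' _ _ ENNReal.ofReal_ne_top
    _ < ⊤ := ENNReal.mul_lt_top ENNReal.ofReal_lt_top (hfin _ hgc.isCompact)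

/-! ### Cutoffs and Hölder's inequality on balls. -/

/-- A smooth cutoff equal to `1` on the ball of radius `ρ`. -/
theorem exists_cutoff (n : ℕ) {ρ : ℝ} (hρ : 0 < ρ) :
    ∃ η : Space n → ℝ, ContDiff ℝ ∞ η ∧ HasCompactSupport η ∧ (∀ x, 0 ≤ η x) ∧
      ∀ x, ‖x‖ < ρ → η =ᶠ[nhds x] 1 := by
  let χ : ContDiffBump (0 : Space n) := ⟨ρ, ρ + 1, hρ, by linarith⟩
  exact ⟨χ, χ.contDiff, χ.hasCompactSupport, fun x => χ.nonneg, fun x hx =>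
    χ.eventuallyEq_one_of_mem_ball (by simpa using hx)⟩

theorem integral_mul_cutoff {n : ℕ} {ρ ρ' : ℝ} (hρ : ρ' < ρ) {f η : Space n → ℝ}
    (hf : ∀ᵐ x : Space n, ρ' < ‖x‖ → f x = 0) (hη : ∀ x, ‖x‖ < ρ → η =ᶠ[nhds x] 1)
    (G : Space n → ℝ) : ∫ x, f x * (η x * G x) = ∫ x, f x * G x := by
  refine integral_congr_ae ?_
  filter_upwards [hf] with x hx
  rcases lt_or_ge ρ' ‖x‖ with h | h
  · simp [hx h]
  · rw [(hη x (h.trans_lt hρ)).eq_of_nhds]; simp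

theorem integral_mul_lap_cutoff {n : ℕ} {ρ ρ' : ℝ} (hρ : ρ' < ρ) {f η : Space n → ℝ}
    (hf : ∀ᵐ x : Space n, ρ' < ‖x‖ → f x = 0) (hη : ∀ x, ‖x‖ < ρ → η =ᶠ[nhds x] 1)
    (G : Space n → ℝ) :
    ∫ x, f x * lap (fun x => η x * G x) x = ∫ x, f x * lap G x := by
  refine integral_congr_ae ?_
  filter_upwards [hf] with x hx
  rcases lt_or_ge ρ' ‖x‖ with h | h
  · simp [hx h]
  · have : (fun x => η x * G x) =ᶠ[nhds x] G := by
      filter_upwards [hη x (h.trans_lt hρ)] with y hy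
      simp [hy]
    rw [lap_congr this]

/-- Hölder's inequality against a continuous weight on a ball. -/
theorem integral_mul_rpow_le {n : ℕ} {f : L2 n} {ρ r : ℝ} (hr : 1 < r)
    (hf : ∀ᵐ x : Space n, ρ < ‖x‖ → f x = 0)
    (hfin : ∫⁻ x in Metric.closedBall (0 : Space n) ρ, ENNReal.ofReal (|f x| ^ r) < ⊤)
    {w : Space n → ℝ} (hw : Continuous w) (hw0 : ∀ x, 0 ≤ w x) (hpos : 0 ≤ ∫ x, f x * w x) :
    (∫ x, f x * w x) ^ r ≤ (∫ x, |f x| ^ r) *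
      (∫ x in Metric.closedBall (0 : Space n) ρ, w x ^ (r / (r - 1))) ^ (r - 1) := by
  have hr0 : 0 < r := by linarith
  obtain ⟨B, hB⟩ : ∃ B, B = Metric.closedBall (0 : Space n) ρ := ⟨_, rfl⟩
  rw [← hB] at hfin ⊢
  have hBm : MeasurableSet B := hB ▸ measurableSet_closedBall
  have hBc : IsCompact B := hB ▸ isCompact_closedBall _ _
  have hout : ∀ᵐ x : Space n, x ∉ B → f x = 0 := by
    filter_upwards [hf] with x hx hxB
    exact hx (by simpa [hB] using hxB)
  have hmeas : Measurable fun x => f x := (Lp.stronglyMeasurable f).measurable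
  have hconj : r.HolderConjugate (r / (r - 1)) := Real.HolderConjugate.conjExponent hr
  have hI : ∀ G : Space n → ℝ, (∀ᵐ x : Space n, x ∉ B → G x = 0) → ∫ x in B, G x = ∫ x, G x :=
    fun G hG => setIntegral_eq_integral_of_ae_compl_eq_zero hG
  have h1 : ∫ x, f x * w x ≤ ∫ x in B, |f x| * w x := by
    rw [← hI (fun x => f x * w x) (by filter_upwards [hout] with x hx hxB; simp [hx hxB])]
    have hi : IntegrableOn (fun x => f x * w x) B := by
      have hwB : MemLp w 2 (volume.restrict B) := by
        obtain ⟨C, hC⟩ := hBc.exists_bound_of_continuousOn hw.continuousOn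
        have : IsFiniteMeasure (volume.restrict B) := ⟨by simpa using hBc.measure_lt_top⟩
        exact MemLp.of_bound hw.aestronglyMeasurable C
          ((ae_restrict_iff' hBm).2 (Filter.Eventually.of_forall hC))
      exact ((Lp.memLp f).restrict B).integrable_mul hwB
    refine integral_mono hi ?_ fun x => mul_le_mul_of_nonneg_right (le_abs_self _) (hw0 x)
    refine hi.norm.congr (Filter.Eventually.of_forall fun x => ?_)
    simp [abs_of_nonneg (hw0 x)]
  -- The finiteness hypothesis is essential: otherwise the Bochner integral of `|f|^r` would be `0`
  -- by convention.
  have hfr : MemLp (fun x => |f x|) (ENNReal.ofReal r) (volume.restrict B) := by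
    refine ⟨hmeas.abs.aestronglyMeasurable, ?_⟩
    rw [eLpNorm_lt_top_iff_lintegral_rpow_enorm_lt_top (by simpa using hr0) ENNReal.ofReal_ne_top,
      ENNReal.toReal_ofReal hr0.le]
    convert hfin using 3 with x
    rw [Real.enorm_eq_ofReal (abs_nonneg _), ENNReal.ofReal_rpow_of_nonneg (abs_nonneg _) hr0.le]
  have hwr : MemLp w (ENNReal.ofReal (r / (r - 1))) (volume.restrict B) := by
    obtain ⟨C, hC⟩ := hBc.exists_bound_of_continuousOn hw.continuousOn
    have : IsFiniteMeasure (volume.restrict B) := ⟨by simpa using hBc.measure_lt_top⟩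
    exact MemLp.of_bound hw.aestronglyMeasurable C
      ((ae_restrict_iff' hBm).2 (Filter.Eventually.of_forall hC))
  have h2 := integral_mul_le_Lp_mul_Lq_of_nonneg (μ := volume.restrict B) hconj
    (Filter.Eventually.of_forall fun x => abs_nonneg (f x)) (Filter.Eventually.of_forall hw0)
    hfr hwr
  have h3 : ∫ x in B, |f x| ^ r = ∫ x, |f x| ^ r := hI _ (by
    filter_upwards [hout] with x hx hxB
    rw [hx hxB, abs_zero, Real.zero_rpow hr0.ne'])
  rw [h3] at h2
  have h4 := Real.rpow_le_rpow hpos (h1.trans h2) hr0.le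
  have hA : 0 ≤ ∫ x, |f x| ^ r := integral_nonneg fun x => by positivity
  have hW : 0 ≤ ∫ x in B, w x ^ (r / (r - 1)) :=
    integral_nonneg fun x => Real.rpow_nonneg (hw0 x) _
  rw [Real.mul_rpow (by positivity) (by positivity), ← Real.rpow_mul hA, ← Real.rpow_mul hW] at h4
  have h5 : 1 / r * r = 1 := by field_simp
  have h6 : 1 / (r / (r - 1)) * r = r - 1 := by
    have : r - 1 ≠ 0 := by linarith
    field_simp
  rwa [h5, h6, Real.rpow_one] at h4

/-! ### Lower bounds for the mean and for the `Φ`-weighted mean. -/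

theorem exp_integral_le {b : ℝ → ℝ} (hb_int : IntegrableOn b (Ici 0))
    (hb0 : ∀ t, 0 ≤ t → 0 ≤ b t) {s : ℝ} (hs : 0 ≤ s) :
    Real.exp (∫ r in (0 : ℝ)..s, b r) ≤ Real.exp (∫ r in Ici 0, b r) := by
  rw [Real.exp_le_exp, intervalIntegral.integral_of_le hs]
  refine setIntegral_mono_set hb_int ?_ (Filter.Eventually.of_forall fun x hx => le_of_lt hx.1)
  exact (ae_restrict_iff' measurableSet_Ici).2 (Filter.Eventually.of_forall fun x hx => hb0 x hx)

theorem monotoneOn_source {n : ℕ} {r ε : ℝ} (hr : 0 ≤ r) {f₁ : Space n → ℝ} {T : ℝ≥0∞}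
    {v vt : ℝ → L2 n} {Dv : ℝ → L2Vec n} (hv : EnergyClass T r v vt Dv) {g : Space n → ℝ}
    (hg : Continuous g) (hgc : HasCompactSupport g) (hg0 : ∀ x, 0 ≤ g x) {t : ℝ}
    (ht : t ∈ timeInterval T) :
    MonotoneOn (fun s => ε * (∫ x, f₁ x * g x) + ∫ τ in (0 : ℝ)..s, ∫ x, |v τ x| ^ r * g x)
      (Icc 0 t) :=
  monotoneOn_const.add (monotoneOn_primitive
    (integrableOn_integral_rpow (hv.continuousOn.mono (Icc_subset_timeInterval ht)) hr
      (hv.locIntegrable t ht) hg hgc hg0)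
    fun _ _ => integral_nonneg fun x => mul_nonneg (by positivity) (hg0 x))

theorem integral_mul_nonneg {n : ℕ} {f g : Space n → ℝ} (hf : 0 ≤ᵐ[volume] f)
    (hg : ∀ x, 0 ≤ g x) : 0 ≤ ∫ x, f x * g x :=
  integral_nonneg_of_ae (by filter_upwards [hf] with x hx using mul_nonneg hx (hg x))

/-- A cutoff equal to `1` on the cone up to time `t` annihilates the Laplacian. Then `M U'`
dominates the integrated source, which is at least `k (s - a)`, and a second integration gives the
square; nonnegative data make `U a ≥ 0`. -/
theorem le_integral_of_source_ge {n : ℕ} {b : ℝ → ℝ} (hb_cont : ContinuousOn b (Ici 0))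
    (hb_int : IntegrableOn b (Ici 0)) (hb0 : ∀ t, 0 ≤ t → 0 ≤ b t) {p q ε R : ℝ} (hp : 1 < p)
    (hε : 0 < ε) (hR : 0 < R) {f₀ f₁ : Space n → ℝ} (hf₀ : 0 ≤ᵐ[volume] f₀)
    (hf₁ : 0 ≤ᵐ[volume] f₁) {T : ℝ≥0∞} {u ut v vt : ℝ → L2 n} {Du Dv : ℝ → L2Vec n}
    (hu : EnergyClass T q u ut Du) (hv : EnergyClass T p v vt Dv)
    (hu0 : u 0 =ᵐ[volume] fun x => ε * f₀ x) (h : WeakWaveEquation b p ε f₁ T ut Du v)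
    (husupp : SupportedInCone R T u) (hvsupp : SupportedInCone R T v) {a t k : ℝ}
    (ha : 0 ≤ a) (hat : a ≤ t) (ht : t ∈ timeInterval T)
    (hN : ∀ᵐ s : ℝ, s ∈ Icc a t → k ≤ ∫ x, |v s x| ^ p) :
    k * (t - a) ^ 2 / (2 * Real.exp (∫ r in Ici 0, b r)) ≤ ∫ x, u t x := by
  obtain ⟨M, hM⟩ : ∃ M, M = Real.exp (∫ r in Ici 0, b r) := ⟨_, rfl⟩
  have hM0 : 0 < M := hM ▸ Real.exp_pos _
  have ht0 : 0 ≤ t := ht.1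
  obtain ⟨g, hg, hgc, hg0, hg1⟩ := exists_cutoff n (show 0 < t + R + 1 by linarith)
  have hsub : Icc 0 t ⊆ timeInterval T := Icc_subset_timeInterval ht
  have h0t : (0 : ℝ) ∈ Icc 0 t := ⟨le_rfl, ht0⟩
  have hlt : ∀ s ∈ Icc 0 t, s + R < t + R + 1 := fun s hs => by linarith [hs.2]
  have hg2 : MemLp g 2 := hg.continuous.memLp_of_hasCompactSupport hgc
  have hU : ∀ s ∈ Icc 0 t, ∫ x, u s x * g x = ∫ x, u s x := fun s hs => by
    simpa using integral_mul_cutoff (hlt s hs) (husupp s (hsub hs)) hg1 (fun _ => 1)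
  have hNg : ∀ s ∈ Icc 0 t, ∫ x, |v s x| ^ p * g x = ∫ x, |v s x| ^ p := fun s hs => by
    have hz : ∀ᵐ x : Space n, s + R < ‖x‖ → |v s x| ^ p = 0 := by
      filter_upwards [hvsupp s (hsub hs)] with x hx hxR
      rw [hx hxR, abs_zero, Real.zero_rpow (by linarith)]
    simpa using integral_mul_cutoff (hlt s hs) hz hg1 (fun _ => 1)
  have hlap : ∀ s ∈ Icc 0 t, ∫ x, u s x * lap g x = 0 := fun s hs => by
    have := integral_mul_lap_cutoff (hlt s hs) (husupp s (hsub hs)) hg1 (fun _ => 1)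
    simpa [lap_const] using this
  obtain ⟨P, hPdef⟩ : ∃ P : ℝ → ℝ, P = fun s => ε * (∫ x, f₁ x * g x) +
    ∫ τ in (0 : ℝ)..s, ∫ x, |v τ x| ^ p * g x := ⟨_, rfl⟩
  have hP : MonotoneOn P (Icc 0 t) := hPdef ▸
    monotoneOn_source (by linarith) hv hg.continuous hgc hg0 ht
  have hNint := integrableOn_integral_rpow (hv.continuousOn.mono hsub) (by linarith : 0 ≤ p)
    (hv.locIntegrable t ht) hg.continuous hgc hg0
  have hP0 : 0 ≤ P 0 := by
    simp only [hPdef, intervalIntegral.integral_same, add_zero]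
    exact mul_nonneg hε.le (integral_mul_nonneg hf₁ hg0)
  have hy : ContinuousOn (fun s => ∫ x, ut s x * g x) (Icc 0 t) :=
    continuousOn_pairing hg2 (hu.continuousOn_deriv.mono hsub)
  have hbt : ContinuousOn b (Icc 0 t) := hb_cont.mono fun s hs => hs.1
  have hyP : ∀ s ∈ Icc 0 t, P s ≤ M * ∫ x, ut s x * g x := fun s hs => by
    have hss : Icc 0 s ⊆ Icc 0 t := Icc_subset_Icc_right hs.2
    have h1 := dampedPrimitive_le (P := P) hs.1 (hbt.mono hss) (fun r hr => hb0 r hr.1)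
      (hy.mono hss) (hP.mono hss) (fun r hr => by
        have h2 := h.spatial hu.hasWeakGradient hg hgc (hsub (hss hr))
        rw [h2, hPdef]
        have h3 : ∫ τ in (0 : ℝ)..r, ∫ x, u τ x * lap g x = ∫ τ in (0 : ℝ)..r, (0 : ℝ) :=
          intervalIntegral.integral_congr fun τ hτ => by
            rw [uIcc_of_le hr.1] at hτ
            exact hlap τ ⟨hτ.1, hτ.2.trans (hss hr).2⟩
        rw [h3]; simp)
    have hy0 : 0 ≤ ∫ x, ut s x * g x := by
      by_contra hc
      have := mul_neg_of_pos_of_neg (Real.exp_pos (∫ r in (0 : ℝ)..s, b r)) (not_le.1 hc)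
      linarith [hP h0t hs hs.1]
    exact h1.trans (mul_le_mul_of_nonneg_right (hM ▸ exp_integral_le hb_int hb0 hs.1) hy0)
  have hPk : ∀ s ∈ Icc a t, k * (s - a) ≤ P s := fun s hs => by
    have hi : ∀ {c d : ℝ}, c ∈ Icc 0 t → d ∈ Icc 0 t → IntervalIntegrable
        (fun s => ∫ x, |v s x| ^ p * g x) volume c d := fun hc hd => by
      rw [intervalIntegrable_iff]
      exact hNint.mono_set (uIoc_subset_uIcc.trans (uIcc_subset_Icc hc hd))
    have hs0 : s ∈ Icc 0 t := ⟨ha.trans hs.1, hs.2⟩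
    have ha0 : a ∈ Icc 0 t := ⟨ha, hat⟩
    have h1 := intervalIntegral.integral_add_adjacent_intervals (hi h0t ha0) (hi ha0 hs0)
    have h2 := hP h0t ha0 ha
    have h3 : ∫ τ in a..s, k ≤ ∫ τ in a..s, ∫ x, |v τ x| ^ p * g x := by
      refine intervalIntegral.integral_mono_ae_restrict hs.1 (by simp) (hi ha0 hs0) ?_
      refine (ae_restrict_iff' measurableSet_Icc).2 ?_
      filter_upwards [hN] with τ hτ hτm
      rw [hNg τ ⟨ha.trans hτm.1, hτm.2.trans hs.2⟩]
      exact hτ ⟨hτm.1, hτm.2.trans hs.2⟩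
    rw [intervalIntegral.integral_const, smul_eq_mul] at h3
    simp only [hPdef, intervalIntegral.integral_same, add_zero] at h2 hP0 ⊢
    linarith
  have hUd : ∀ s ∈ Icc 0 t, HasDerivWithinAt (fun s => ∫ x, u s x * g x) (∫ x, ut s x * g x)
      (Icc 0 t) s := fun s hs => (hasDerivWithinAt_pairing hg2 (hu.hasDeriv s (hsub hs))).mono hsub
  have hUd' : ∀ s ∈ Ioo 0 t, HasDerivAt (fun s => ∫ x, u s x * g x) (∫ x, ut s x * g x) s :=
    fun s hs => (hUd s ⟨hs.1.le, hs.2.le⟩).hasDerivAt (Icc_mem_nhds hs.1 hs.2)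
  have hUc : ContinuousOn (fun s => ∫ x, u s x * g x) (Icc 0 t) :=
    fun s hs => (hUd s hs).continuousWithinAt
  have hmono : MonotoneOn (fun s => ∫ x, u s x * g x) (Icc 0 t) := by
    refine monotoneOn_of_deriv_nonneg (convex_Icc 0 t) hUc ?_ ?_
    · rw [interior_Icc]
      exact fun s hs => (hUd' s hs).differentiableAt.differentiableWithinAt
    · rw [interior_Icc]
      intro s hs
      rw [(hUd' s hs).deriv]
      have h1 := hyP s ⟨hs.1.le, hs.2.le⟩
      have h2 := hP h0t ⟨hs.1.le, hs.2.le⟩ hs.1.le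
      exact nonneg_of_mul_nonneg_right (by linarith) hM0
  have hU0 : 0 ≤ ∫ x, u 0 x * g x := by
    refine integral_mul_nonneg ?_ hg0
    filter_upwards [hu0, hf₀] with x hx hx0
    rw [hx]
    exact mul_nonneg hε.le hx0
  have hmono2 : MonotoneOn (fun s => (∫ x, u s x * g x) - k / (2 * M) * (s - a) ^ 2)
      (Icc a t) := by
    have hd : ∀ s ∈ Ioo a t, HasDerivAt (fun s => (∫ x, u s x * g x) - k / (2 * M) * (s - a) ^ 2)
        ((∫ x, ut s x * g x) - k * (s - a) / M) s := fun s hs => by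
      have h1 := (((hasDerivAt_id s).sub_const a).pow 2).const_mul (k / (2 * M))
      have h2 := (hUd' s ⟨ha.trans_lt hs.1, hs.2⟩).sub h1
      have h3 : HasDerivAt (fun s => (∫ x, u s x * g x) - k / (2 * M) * (s - a) ^ 2) _ s := h2
      convert h3 using 1
      simp only [id]
      field_simp
      push_cast
      ring
    refine monotoneOn_of_deriv_nonneg (convex_Icc a t) ?_ ?_ ?_
    · exact (hUc.mono (Icc_subset_Icc_left ha)).sub (by fun_prop)
    · rw [interior_Icc]
      exact fun s hs => (hd s hs).differentiableAt.differentiableWithinAt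
    · rw [interior_Icc]
      intro s hs
      rw [(hd s hs).deriv, sub_nonneg, div_le_iff₀ hM0]
      have h1 := hyP s ⟨ha.trans hs.1.le, hs.2.le⟩
      have h2 := hPk s ⟨hs.1.le, hs.2.le⟩
      linarith
  have h1 := hmono2 ⟨le_rfl, hat⟩ ⟨hat, le_rfl⟩ hat
  have h2 := hmono h0t ⟨ha, hat⟩ ha
  simp only [sub_self, ne_eq, OfNat.ofNat_ne_zero, not_false_eq_true, zero_pow, mul_zero,
    sub_zero] at h1 h2
  rw [hU t ⟨ht0, le_rfl⟩] at h1
  rw [← hM]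
  have h3 : k * (t - a) ^ 2 / (2 * M) = k / (2 * M) * (t - a) ^ 2 := by ring
  linarith

/-- As `ΔΦ = Φ` on the support of `u`, the weighted mean solves the equation of
`exp_le_of_volterra`, with the nonlinearity as nonnegative source. Here `c ε e^t` depends on the
data alone. -/
theorem exp_le_integral_radialExp {n : ℕ} (hn : 1 ≤ n) {b : ℝ → ℝ}
    (hb_cont : ContinuousOn b (Ici 0))
    (hb_int : IntegrableOn b (Ici 0)) (hb0 : ∀ t, 0 ≤ t → 0 ≤ b t) {p q ε R : ℝ} (hp : 1 < p)
    (hε : 0 < ε) (hR : 0 < R) {f₀ f₁ : Space n → ℝ} (hf₀ : 0 ≤ᵐ[volume] f₀)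
    (hf₁ : 0 ≤ᵐ[volume] f₁) (hf₀supp : ∀ᵐ x : Space n, R < ‖x‖ → f₀ x = 0)
    (hf₁supp : ∀ᵐ x : Space n, R < ‖x‖ → f₁ x = 0)
    (hpos : 0 < (∫ x, f₀ x * radialExp n x) + ∫ x, f₁ x * radialExp n x)
    {T : ℝ≥0∞} {u ut v vt : ℝ → L2 n} {Du Dv : ℝ → L2Vec n}
    (hu : EnergyClass T q u ut Du) (hv : EnergyClass T p v vt Dv)
    (hu0 : u 0 =ᵐ[volume] fun x => ε * f₀ x) (h : WeakWaveEquation b p ε f₁ T ut Du v)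
    (husupp : SupportedInCone R T u) {t : ℝ} (ht1 : 1 ≤ t) (ht : t ∈ timeInterval T) :
    ((∫ x, f₀ x * radialExp n x) + ∫ x, f₁ x * radialExp n x) /
      (4 * Real.exp (∫ r in Ici 0, b r)) * ε * Real.exp t ≤ ∫ x, u t x * radialExp n x := by
  have ht0 : 0 ≤ t := ht.1
  obtain ⟨η, hη, hηc, hη0, hη1⟩ := exists_cutoff n (show 0 < t + R + 1 by linarith)
  obtain ⟨g, hgdef⟩ : ∃ g : Space n → ℝ, g = fun x => η x * radialExp n x := ⟨_, rfl⟩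
  have hg : ContDiff ℝ ∞ g := hgdef ▸ hη.mul (contDiff_radialExp hn)
  have hgc : HasCompactSupport g := hgdef ▸ hηc.mul_right
  have hg0 : ∀ x, 0 ≤ g x := fun x => by
    rw [hgdef]
    exact mul_nonneg (hη0 x) (zero_le_one.trans (one_le_radialExp hn x))
  have hsub : Icc 0 t ⊆ timeInterval T := Icc_subset_timeInterval ht
  have h0t : (0 : ℝ) ∈ Icc 0 t := ⟨le_rfl, ht0⟩
  have hlt : ∀ s ∈ Icc 0 t, s + R < t + R + 1 := fun s hs => by linarith [hs.2]
  have hg2 : MemLp g 2 := hg.continuous.memLp_of_hasCompactSupport hgc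
  have hU : ∀ s ∈ Icc 0 t, ∫ x, u s x * g x = ∫ x, u s x * radialExp n x := fun s hs => by
    rw [hgdef]
    exact integral_mul_cutoff (hlt s hs) (husupp s (hsub hs)) hη1 _
  have hlap : ∀ s ∈ Icc 0 t, ∫ x, u s x * lap g x = ∫ x, u s x * g x := fun s hs => by
    have := integral_mul_lap_cutoff (hlt s hs) (husupp s (hsub hs)) hη1 (radialExp n)
    simp only [lap_radialExp hn] at this
    rw [hU s hs, ← this, hgdef]
  have hRlt : R < t + R + 1 := by linarith
  have hW0 : ∫ x, u 0 x * g x = ε * ∫ x, f₀ x * radialExp n x := by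
    rw [← integral_mul_cutoff hRlt hf₀supp hη1, ← integral_const_mul, hgdef]
    refine integral_congr_ae ?_
    filter_upwards [hu0] with x hx
    rw [hx, mul_assoc]
  have hF1 : ∫ x, f₁ x * g x = ∫ x, f₁ x * radialExp n x := by
    rw [hgdef]
    exact integral_mul_cutoff hRlt hf₁supp hη1 _
  have hΦ0 : ∀ x, 0 ≤ radialExp n x := fun x => zero_le_one.trans (one_le_radialExp hn x)
  have key := exp_le_of_volterra (b := b) (W := fun s => ∫ x, u s x * g x)
    (y := fun s => ∫ x, ut s x * g x) (P := fun s => ε * (∫ x, f₁ x * g x) +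
      ∫ τ in (0 : ℝ)..s, ∫ x, |v τ x| ^ p * g x) ht1 (hb_cont.mono fun s hs => hs.1)
    (fun s hs => hb0 s hs.1) (fun s hs => exp_integral_le hb_int hb0 hs.1)
    (fun s hs => (hasDerivWithinAt_pairing hg2 (hu.hasDeriv s (hsub hs))).mono hsub)
    (continuousOn_pairing hg2 (hu.continuousOn_deriv.mono hsub))
    (monotoneOn_source (by linarith) hv hg.continuous hgc hg0 ht)
    (fun s hs => by
      rw [h.spatial hu.hasWeakGradient hg hgc (hsub hs)]
      congr 1
      refine intervalIntegral.integral_congr fun τ hτ => ?_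
      rw [uIcc_of_le hs.1] at hτ
      exact hlap τ ⟨hτ.1, hτ.2.trans hs.2⟩)
  simp only [intervalIntegral.integral_same, add_zero, hW0, hF1, hU t ⟨ht0, le_rfl⟩] at key
  refine le_trans (le_of_eq ?_) (key (mul_nonneg hε.le (integral_mul_nonneg hf₀ hΦ0))
    (mul_nonneg hε.le (integral_mul_nonneg hf₁ hΦ0)) ?_)
  · ring
  · rw [← mul_add]
    exact mul_pos hε hpos

theorem integral_radialExp_pos {n : ℕ} (hn : 1 ≤ n) {R : ℝ} {f : Space n → ℝ} (hf : MemLp f 2)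
    (hf0 : 0 ≤ᵐ[volume] f) (hsupp : ∀ᵐ x : Space n, R < ‖x‖ → f x = 0)
    (hne : ¬ f =ᵐ[volume] 0) : 0 < ∫ x, f x * radialExp n x := by
  have hΦ : ∀ x : Space n, 0 < radialExp n x := fun x =>
    zero_lt_one.trans_le (one_le_radialExp hn x)
  obtain ⟨η, hη, hηc, hη0, hη1⟩ := exists_cutoff n (show 0 < max R 0 + 1 by positivity)
  have hi : Integrable fun x => f x * (η x * radialExp n x) :=
    hf.integrable_mul ((hη.mul (contDiff_radialExp hn)).continuous.memLp_of_hasCompactSupport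
      (p := 2) hηc.mul_right)
  have hi' : Integrable fun x => f x * radialExp n x := by
    refine hi.congr ?_
    filter_upwards [hsupp] with x hx
    rcases lt_or_ge R ‖x‖ with h | h
    · simp [hx h]
    · rw [(hη1 x (by linarith [le_max_left R 0])).eq_of_nhds]; simp
  have hnn : 0 ≤ᵐ[volume] fun x => f x * radialExp n x := by
    filter_upwards [hf0] with x hx using mul_nonneg hx (hΦ x).le
  refine lt_of_le_of_ne (integral_nonneg_of_ae hnn) fun h0 => hne ?_
  filter_upwards [(integral_eq_zero_iff_of_nonneg_ae hnn hi').1 h0.symm] with x hx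
  simpa [(hΦ x).ne'] using hx

theorem integral_data_radialExp_pos {n : ℕ} (hn : 1 ≤ n) {R : ℝ} {f₀ f₁ : Space n → ℝ}
    (hf₀ : MemLp f₀ 2) (hf₁ : MemLp f₁ 2) (hf₀0 : 0 ≤ᵐ[volume] f₀) (hf₁0 : 0 ≤ᵐ[volume] f₁)
    (hf₀supp : ∀ᵐ x : Space n, R < ‖x‖ → f₀ x = 0) (hf₁supp : ∀ᵐ x : Space n, R < ‖x‖ → f₁ x = 0)
    (hne : ¬ (f₀ =ᵐ[volume] 0 ∧ f₁ =ᵐ[volume] 0)) :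
    0 < (∫ x, f₀ x * radialExp n x) + ∫ x, f₁ x * radialExp n x := by
  have hΦ0 : ∀ x : Space n, 0 ≤ radialExp n x := fun x =>
    zero_le_one.trans (one_le_radialExp hn x)
  by_cases h : f₀ =ᵐ[volume] 0
  · exact add_pos_of_nonneg_of_pos (integral_mul_nonneg hf₀0 hΦ0)
      (integral_radialExp_pos hn hf₁ hf₁0 hf₁supp fun h1 => hne ⟨h, h1⟩)
  · exact add_pos_of_pos_of_nonneg (integral_radialExp_pos hn hf₀ hf₀0 hf₀supp h)
      (integral_mul_nonneg hf₁0 hΦ0)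

/-! ### The iteration between the two means. -/

theorem exists_blowup_threshold {c p q : ℝ} (n : ℝ) (hc : 0 < c) (hp : 1 < p) (hq : 1 < q) :
    ∃ K, 0 < K ∧ ∀ (L : ℝ) (U V : ℝ → ℝ), 0 < L →
      (∀ a ∈ Icc L (4 * L), ∀ k, 0 ≤ k → (∀ s ∈ Icc a (4 * L), k ≤ U s) → ∀ δ, 0 ≤ δ →
        ∀ t ∈ Icc (a + δ) (4 * L), c * L ^ (-(n * (q - 1))) * k ^ q * δ ^ 2 ≤ V t) →
      (∀ a ∈ Icc L (4 * L), ∀ k, 0 ≤ k → (∀ s ∈ Icc a (4 * L), k ≤ V s) → ∀ δ, 0 ≤ δ →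
        ∀ t ∈ Icc (a + δ) (4 * L), c * L ^ (-(n * (p - 1))) * k ^ p * δ ^ 2 ≤ U t) →
      ∀ k₀, (∀ t ∈ Icc (2 * L) (4 * L), k₀ ≤ U t) →
        k₀ < K * L ^ (n - (2 * p + 2) / (p * q - 1)) := by
  have hpq : 0 < p * q - 1 := by nlinarith
  obtain ⟨m, hm⟩ : ∃ m, m = 2 * p + 2 := ⟨_, rfl⟩
  have hm0 : 0 < m := by linarith
  -- A round maps `k` to `c^(1+p) k^(pq) (2^(-j)/4)^m`. The choice `D^(pq-1) = 2^m` compensates the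
  -- shrinking time steps, and `K^(pq-1) = Q` makes each round multiply `K D^j` by exactly `D`.
  obtain ⟨D, hD⟩ : ∃ D : ℝ, D = 2 ^ (m / (p * q - 1)) := ⟨_, rfl⟩
  have hD1 : 1 < D := hD ▸ Real.one_lt_rpow one_lt_two (by positivity)
  have hD0 : 0 < D := by linarith
  have hDpow : D ^ (p * q - 1) = 2 ^ m := by
    rw [hD, ← Real.rpow_mul two_pos.le]
    congr 1
    field_simp
  obtain ⟨Q, hQ⟩ : ∃ Q : ℝ, Q = D * 4 ^ m / c ^ (1 + p) := ⟨_, rfl⟩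
  have hQ0 : 0 < Q := by rw [hQ]; positivity
  obtain ⟨K, hK⟩ : ∃ K : ℝ, K = Q ^ (p * q - 1)⁻¹ := ⟨_, rfl⟩
  have hK0 : 0 < K := by rw [hK]; positivity
  have hKpow : K ^ (p * q - 1) = Q := by
    rw [hK, Real.rpow_inv_rpow hQ0.le hpq.ne']
  refine ⟨K, hK0, fun L U V hL hV hU k₀ h0 => ?_⟩
  rw [← hm]
  by_contra! hcon
  -- `α` is the scaling exponent fixed by a round: `α p q - n(p-1) - n(q-1)p + 2p + 2 = α`.
  obtain ⟨α, hα⟩ : ∃ α, α = n - m / (p * q - 1) := ⟨_, rfl⟩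
  rw [← hα] at hcon
  have hαe : α * (p * q - 1) = n * (p * q - 1) - m := by rw [hα]; field_simp
  -- A round uses two delays of length `2^(-j) L / 4`, so the left endpoints stay below `3L` while
  -- the lower bound grows like `D^j` with `D > 1`; this is impossible at the fixed time `3L`.
  have hstep : ∀ j : ℕ, ∀ t ∈ Icc ((3 - (1 / 2) ^ j) * L) (4 * L), K * D ^ j * L ^ α ≤ U t := by
    intro j
    induction j with
    | zero =>
      intro t ht
      simp only [pow_zero, mul_one] at ht ⊢
      exact hcon.trans (h0 t ⟨by linarith [ht.1], ht.2⟩)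
    | succ j ih =>
      intro t ht
      obtain ⟨x, hx⟩ : ∃ x : ℝ, x = (1 / 2) ^ j := ⟨_, rfl⟩
      have hx0 : 0 < x := by rw [hx]; positivity
      have hx1 : x ≤ 1 := hx ▸ pow_le_one₀ (by norm_num) (by norm_num)
      rw [pow_succ, ← hx] at ht
      rw [← hx] at ih
      obtain ⟨k, hk⟩ : ∃ k, k = K * D ^ j := ⟨_, rfl⟩
      have hk0 : 0 < k := by rw [hk]; positivity
      rw [← hk] at ih
      have hkL : 0 ≤ k * L ^ α := by positivity
      have hδ : 0 ≤ x / 4 * L := by positivity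
      have hk1 : 0 ≤ c * L ^ (-(n * (q - 1))) * (k * L ^ α) ^ q * (x / 4 * L) ^ 2 := by positivity
      have h1 := hV ((3 - x) * L) ⟨by nlinarith, by nlinarith⟩ _ hkL ih _ hδ
      have h2 := hU ((3 - x) * L + x / 4 * L) ⟨by nlinarith, by nlinarith⟩ _ hk1 h1 _ hδ t
        ⟨by linarith [ht.1], ht.2⟩
      refine le_trans (le_of_eq ?_) h2
      have hd : x / 4 = 2 ^ (-(j : ℝ)) / 4 := by
        rw [hx, Real.rpow_neg two_pos.le, Real.rpow_natCast, one_div, inv_pow]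
      have hd0 : 0 < x / 4 := by positivity
      have hsplit : c * L ^ (-(n * (p - 1))) *
          (c * L ^ (-(n * (q - 1))) * (k * L ^ α) ^ q * (x / 4 * L) ^ 2) ^ p * (x / 4 * L) ^ 2 =
          c ^ (1 + p) * k ^ (p * q) * (x / 4) ^ m * L ^ α := by
        have e1 : (c * L ^ (-(n * (q - 1))) * (k * L ^ α) ^ q * (x / 4 * L) ^ 2) ^ p =
            c ^ p * L ^ (-(n * (q - 1)) * p) * (k ^ (q * p) * L ^ (α * (q * p))) *
              ((x / 4) ^ (2 * p) * L ^ (2 * p)) := by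
          have e3 : ((x / 4 * L) ^ 2) ^ p = (x / 4) ^ (2 * p) * L ^ (2 * p) := by
            rw [← Real.rpow_natCast, ← Real.rpow_mul (by positivity),
              Real.mul_rpow (by positivity) (by positivity)]
            norm_num
          rw [Real.mul_rpow (by positivity) (by positivity), e3,
            Real.mul_rpow (by positivity) (by positivity),
            Real.mul_rpow (by positivity) (by positivity), ← Real.rpow_mul hL.le,
            ← Real.rpow_mul (by positivity), Real.mul_rpow (by positivity) (by positivity),
            ← Real.rpow_mul hL.le]
        rw [e1, Real.rpow_add hc, Real.rpow_one, mul_comm q p, hm, Real.rpow_add hd0 (2 * p) 2,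
          mul_pow, ← Real.rpow_natCast (x / 4) 2, ← Real.rpow_natCast L 2]
        have e2 : L ^ α = L ^ (-(n * (p - 1))) * L ^ (-(n * (q - 1)) * p) * L ^ (α * (p * q)) *
            L ^ (2 * p) * L ^ ((2 : ℕ) : ℝ) := by
          rw [← Real.rpow_add hL, ← Real.rpow_add hL, ← Real.rpow_add hL, ← Real.rpow_add hL]
          congr 1
          push_cast
          linear_combination (-1 : ℝ) * hαe + hm
        rw [e2]
        push_cast
        ring
      rw [hsplit]
      have hkk : k ^ (p * q) = k * k ^ (p * q - 1) := by
        rw [← Real.rpow_one_add' hk0.le (by linarith)]; ring_nf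
      have hkp : k ^ (p * q - 1) = Q * 2 ^ (m * j) := by
        rw [hk, Real.mul_rpow hK0.le (by positivity), hKpow, ← Real.rpow_natCast D j,
          ← Real.rpow_mul hD0.le, mul_comm (j : ℝ), Real.rpow_mul hD0.le, hDpow,
          ← Real.rpow_mul two_pos.le]
      have hdm : (x / 4) ^ m = 2 ^ (-(m * j)) / 4 ^ m := by
        rw [hd, Real.div_rpow (by positivity) (by positivity), ← Real.rpow_mul two_pos.le]
        congr 2
        ring
      have h4 : (0 : ℝ) < 4 ^ m := by positivity
      have h2m : (0 : ℝ) < 2 ^ (m * j) := by positivity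
      have hcp : 0 < c ^ (1 + p) := by positivity
      rw [hkk, hkp, hdm, hQ, Real.rpow_neg two_pos.le, pow_succ, ← mul_assoc K, ← hk]
      field_simp
  have hb : ∀ j : ℕ, D ^ j ≤ U (3 * L) / (K * L ^ α) := fun j => by
    have hx : (0 : ℝ) < (1 / 2) ^ j := by positivity
    have := hstep j (3 * L) ⟨by nlinarith, by linarith⟩
    rw [le_div_iff₀ (by positivity)]
    linarith
  obtain ⟨j, hj⟩ := pow_unbounded_of_one_lt (U (3 * L) / (K * L ^ α)) hD1
  exact absurd (hb j) (not_le.2 hj)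

/-! ### Lower bounds for the source and the mean on `[L, 4L]`. -/

theorem rpow_mul_min_le {κ L x : ℝ} (hL : 0 < L) (hκ : 1 ≤ κ) (hx : L ≤ x) (hxκ : x ≤ κ * L)
    (e : ℝ) : min 1 (κ ^ e) * L ^ e ≤ x ^ e := by
  have hLe : 0 < L ^ e := by positivity
  rcases le_total 0 e with he | he
  · calc min 1 (κ ^ e) * L ^ e ≤ 1 * L ^ e := by gcongr; exact min_le_left _ _
      _ ≤ x ^ e := by rw [one_mul]; gcongr
  · calc min 1 (κ ^ e) * L ^ e ≤ κ ^ e * L ^ e := by gcongr; exact min_le_right _ _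
      _ = (κ * L) ^ e := (Real.mul_rpow (by linarith) hL.le).symm
      _ ≤ x ^ e := Real.rpow_le_rpow_of_nonpos (by linarith) hxκ he

/-- Hölder with weight `1` on the ball of radius `4L + R ≤ (4 + R) L`. It holds for almost every `s`
only, since `|v(s)|^r` is known to be integrable only at almost every time. -/
theorem exists_rpow_integral_le_source (n : ℕ) {r R : ℝ} (hr : 1 < r) (hR : 0 < R) :
    ∃ c, 0 < c ∧ ∀ (T : ℝ≥0∞) (v vt : ℝ → L2 n) (Dv : ℝ → L2Vec n), EnergyClass T r v vt Dv →
      SupportedInCone R T v → ∀ L, 1 ≤ L → 4 * L ∈ timeInterval T →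
      ∀ᵐ s : ℝ, s ∈ Icc L (4 * L) → 0 ≤ ∫ x, v s x →
        c * L ^ (-((n : ℝ) * (r - 1))) * (∫ x, v s x) ^ r ≤ ∫ x, |v s x| ^ r := by
  obtain ⟨c₁, hc1⟩ : ∃ c₁, c₁ = volume.real (Metric.ball (0 : Space n) 1) := ⟨_, rfl⟩
  have hc10 : 0 < c₁ := by
    rw [hc1]
    exact ENNReal.toReal_pos (Metric.measure_ball_pos _ _ one_pos).ne' measure_ball_lt_top.ne
  have hr0 : 0 < r - 1 := by linarith
  refine ⟨(((4 + R) ^ n * c₁) ^ (r - 1))⁻¹, by positivity,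
    fun T v vt Dv hv hsupp L hL hT => ?_⟩
  have hsub := Icc_subset_timeInterval hT
  have hae := ae_lintegral_rpow_lt_top (hv.continuousOn.mono hsub) (by linarith : 0 ≤ r)
    (isCompact_closedBall (0 : Space n) (4 * L + R)) (hv.locIntegrable _ hT _
      (isCompact_closedBall _ _))
  filter_upwards [(ae_restrict_iff' measurableSet_Icc).1 hae] with s hs hsL hpos
  have hs0 : s ∈ Icc 0 (4 * L) := ⟨by linarith [hsL.1], hsL.2⟩
  have hz : ∀ᵐ x : Space n, 4 * L + R < ‖x‖ → v s x = 0 := by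
    filter_upwards [hsupp s (hsub hs0)] with x hx hxx
    exact hx (by linarith [hs0.2])
  have h1 := integral_mul_rpow_le hr hz (hs hs0) (w := fun _ => 1) continuous_const
    (fun _ => zero_le_one) (by simpa using hpos)
  simp only [mul_one, Real.one_rpow, integral_const, smul_eq_mul,
    measureReal_restrict_apply_univ] at h1
  have h4 : 0 ≤ 4 * L + R := by linarith
  have hvol : volume.real (Metric.closedBall (0 : Space n) (4 * L + R)) = (4 * L + R) ^ n * c₁ := by
    rw [Measure.addHaar_real_closedBall _ _ h4, finrank_euclideanSpace_fin, hc1]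
  rw [hvol] at h1
  have hA : 0 ≤ ∫ x, |v s x| ^ r := integral_nonneg fun x => by positivity
  have hLpos : 0 < L := by linarith
  have h2 : ((4 * L + R) ^ n * c₁) ^ (r - 1) ≤
      ((4 + R) ^ n * c₁) ^ (r - 1) * L ^ ((n : ℝ) * (r - 1)) := by
    rw [Real.rpow_mul hLpos.le, ← Real.mul_rpow (by positivity) (by positivity),
      Real.rpow_natCast]
    refine Real.rpow_le_rpow (by positivity) ?_ hr0.le
    calc (4 * L + R) ^ n * c₁ ≤ ((4 + R) * L) ^ n * c₁ := by gcongr; nlinarith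
      _ = _ := by rw [mul_pow]; ring
  have h3 := h1.trans (mul_le_mul_of_nonneg_left h2 hA)
  rw [Real.rpow_neg hLpos.le, ← mul_inv, inv_mul_le_iff₀ (by positivity)]
  linarith

/-- Hölder with weight `Φ`: with `r' = r/(r-1)`, the power `(∫ Φ^r')^(r-1)` grows like `e^(rs)
s^((n-1)(r/2-1))`. The exponential cancels that of `(c₀ ε e^s)^r` and only the power of time
remains. -/
theorem exists_data_rpow_le_source {n : ℕ} (hn : 1 ≤ n) {r R c₀ : ℝ} (hr : 1 < r) (hR : 0 < R)
    (hc₀ : 0 < c₀) :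
    ∃ c, 0 < c ∧ ∀ (T : ℝ≥0∞) (v vt : ℝ → L2 n) (Dv : ℝ → L2Vec n), EnergyClass T r v vt Dv →
      SupportedInCone R T v → ∀ ε, 0 < ε → (∀ s, 1 ≤ s → s ∈ timeInterval T →
        c₀ * ε * Real.exp s ≤ ∫ x, v s x * radialExp n x) →
      ∀ L, 1 ≤ L → 4 * L ∈ timeInterval T → ∀ᵐ s : ℝ, s ∈ Icc L (4 * L) →
        c * ε ^ r * L ^ (((n : ℝ) - 1) * (1 - r / 2)) ≤ ∫ x, |v s x| ^ r := by
  have hr0 : 0 < r - 1 := by linarith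
  have hr00 : 0 < r := by linarith
  obtain ⟨C, hC, hCI⟩ := exists_integral_radialExp_rpow_le hn (show 0 < r / (r - 1) by positivity)
  obtain ⟨e, he⟩ : ∃ e, e = ((n : ℝ) - 1) * (1 - r / 2) := ⟨_, rfl⟩
  rw [← he]
  obtain ⟨κ, hκ⟩ : ∃ κ, κ = min 1 ((5 + R) ^ e) := ⟨_, rfl⟩
  have hκ0 : 0 < κ := by rw [hκ]; exact lt_min one_pos (by positivity)
  refine ⟨c₀ ^ r / (C ^ (r - 1) * Real.exp (r * R)) * κ, by positivity,
    fun T v vt Dv hv hsupp ε hε hexp L hL hT => ?_⟩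
  have hsub := Icc_subset_timeInterval hT
  have hae : ∀ᵐ s ∂(volume.restrict (Icc 0 (4 * L))),
      ∫⁻ x in Metric.closedBall (0 : Space n) (4 * L + R), ENNReal.ofReal (|v s x| ^ r) < ⊤ :=
    ae_lintegral_rpow_lt_top (hv.continuousOn.mono hsub) hr00.le (isCompact_closedBall _ _)
      (hv.locIntegrable _ hT _ (isCompact_closedBall _ _))
  filter_upwards [(ae_restrict_iff' measurableSet_Icc).1 hae] with s hs hsL
  have hs0 : s ∈ Icc 0 (4 * L) := ⟨by linarith [hsL.1], hsL.2⟩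
  have hfin : ∫⁻ x in Metric.closedBall (0 : Space n) (s + R), ENNReal.ofReal (|v s x| ^ r) < ⊤ :=
    (lintegral_mono_set (Metric.closedBall_subset_closedBall (by linarith [hs0.2]))).trans_lt
      (hs hs0)
  have hW := hexp s (by linarith [hsL.1]) (hsub hs0)
  have hW0 : 0 < c₀ * ε * Real.exp s := by positivity
  have h1 := integral_mul_rpow_le hr (hsupp s (hsub hs0)) hfin (w := radialExp n)
    (contDiff_radialExp hn).continuous
    (fun x => zero_le_one.trans (one_le_radialExp hn x)) (hW0.le.trans hW)
  have hsR : 0 ≤ s + R := by linarith [hs0.1]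
  have h1s : 0 < 1 + (s + R) := by linarith
  have hA : 0 ≤ ∫ x, |v s x| ^ r := integral_nonneg fun x => by positivity
  have hI0 : 0 ≤ ∫ x in Metric.closedBall (0 : Space n) (s + R), radialExp n x ^ (r / (r - 1)) :=
    integral_nonneg fun x => Real.rpow_nonneg (zero_le_one.trans (one_le_radialExp hn x)) _
  have h2 := Real.rpow_le_rpow hI0 (hCI (s + R) hsR) hr0.le
  have h3 := (Real.rpow_le_rpow hW0.le hW hr00.le).trans
    (h1.trans (mul_le_mul_of_nonneg_left h2 hA))
  have e1 : (((n : ℝ) - 1) * (1 - r / (r - 1) / 2)) * (r - 1) = -e := by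
    rw [he]; field_simp; ring
  have e2 : r / (r - 1) * (s + R) * (r - 1) = r * s + r * R := by field_simp
  rw [Real.mul_rpow (by positivity) (by positivity), Real.mul_rpow (by positivity) (by positivity),
    Real.mul_rpow (by positivity) (by positivity), Real.mul_rpow (by positivity) (by positivity),
    ← Real.rpow_mul h1s.le, e1, ← Real.exp_mul, ← Real.exp_mul, e2, Real.exp_add,
    mul_comm s r, Real.rpow_neg h1s.le] at h3
  have hE := Real.exp_pos (r * s)
  have hxe : 0 < (1 + (s + R)) ^ e := by positivity
  have h4 : c₀ ^ r * ε ^ r * (1 + (s + R)) ^ e ≤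
      (∫ x, |v s x| ^ r) * (C ^ (r - 1) * Real.exp (r * R)) := by
    have h5 : (c₀ ^ r * ε ^ r) * Real.exp (r * s) ≤ ((∫ x, |v s x| ^ r) *
        (C ^ (r - 1) * Real.exp (r * R)) / (1 + (s + R)) ^ e) * Real.exp (r * s) := by
      refine h3.trans (le_of_eq ?_)
      field_simp
    have h6 := le_of_mul_le_mul_right h5 hE
    rwa [le_div_iff₀ hxe] at h6
  have h7 : κ * L ^ e ≤ (1 + (s + R)) ^ e := by
    rw [hκ]
    refine rpow_mul_min_le (by linarith) (by linarith) (by linarith [hsL.1]) ?_ e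
    nlinarith [hsL.2]
  rw [show c₀ ^ r / (C ^ (r - 1) * Real.exp (r * R)) * κ * ε ^ r * L ^ e =
    (c₀ ^ r * ε ^ r * (κ * L ^ e)) / (C ^ (r - 1) * Real.exp (r * R)) by ring,
    div_le_iff₀ (by positivity)]
  exact (mul_le_mul_of_nonneg_left h7 (by positivity)).trans h4

/-- A lower bound `k` for the mean of `v` on `[a, 4L]` improves to one for the mean of `u`. -/
theorem exists_mean_step (n : ℕ) {b : ℝ → ℝ} (hb_cont : ContinuousOn b (Ici 0))
    (hb_int : IntegrableOn b (Ici 0)) (hb0 : ∀ t, 0 ≤ t → 0 ≤ b t) {p q R : ℝ} (hp : 1 < p)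
    (hR : 0 < R) {f₀ f₁ : Space n → ℝ} (hf₀ : 0 ≤ᵐ[volume] f₀) (hf₁ : 0 ≤ᵐ[volume] f₁) :
    ∃ c, 0 < c ∧ ∀ (T : ℝ≥0∞) (u ut v vt : ℝ → L2 n) (Du Dv : ℝ → L2Vec n) (ε : ℝ), 0 < ε →
      EnergyClass T q u ut Du → EnergyClass T p v vt Dv →
      (u 0 =ᵐ[volume] fun x => ε * f₀ x) → WeakWaveEquation b p ε f₁ T ut Du v →
      SupportedInCone R T u → SupportedInCone R T v → ∀ L, 1 ≤ L → 4 * L ∈ timeInterval T →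
      ∀ a ∈ Icc L (4 * L), ∀ k, 0 ≤ k → (∀ s ∈ Icc a (4 * L), k ≤ ∫ x, v s x) → ∀ δ, 0 ≤ δ →
        ∀ t ∈ Icc (a + δ) (4 * L),
          c * L ^ (-((n : ℝ) * (p - 1))) * k ^ p * δ ^ 2 ≤ ∫ x, u t x := by
  obtain ⟨c, hc, H⟩ := exists_rpow_integral_le_source n hp hR
  obtain ⟨M, hM⟩ : ∃ M, M = Real.exp (∫ r in Ici 0, b r) := ⟨_, rfl⟩
  have hM0 : 0 < M := hM ▸ Real.exp_pos _
  refine ⟨c / (2 * M), by positivity, ?_⟩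
  intro T u ut v vt Du Dv ε hε hu hv hu0 h hus hvs L hL hT a ha k hk hkv δ hδ t ht
  have hat : a ≤ t := by linarith [ht.1]
  have hLpos : 0 < L := by linarith
  have h1 := le_integral_of_source_ge hb_cont hb_int hb0 hp hε hR hf₀ hf₁ hu hv hu0 h hus hvs
    (k := c * L ^ (-((n : ℝ) * (p - 1))) * k ^ p) (hLpos.le.trans ha.1) hat
    (mem_timeInterval_of_le hT (by linarith [ha.1]) ht.2) (by
      filter_upwards [H T v vt Dv hv hvs L hL hT] with s hs hst
      have hsk := hkv s ⟨hst.1, hst.2.trans ht.2⟩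
      refine le_trans ?_ (hs ⟨ha.1.trans hst.1, hst.2.trans ht.2⟩ (hk.trans hsk))
      gcongr)
  rw [← hM] at h1
  have h2 : δ ^ 2 ≤ (t - a) ^ 2 := by
    have : δ ≤ t - a := by linarith [ht.1]
    gcongr
  refine le_trans (le_of_eq_of_le ?_ (div_le_div_of_nonneg_right
    (mul_le_mul_of_nonneg_left h2 (by positivity)) (by positivity))) h1
  ring

theorem exists_mean_ge_of_data {n : ℕ} (hn : 1 ≤ n) {b₁ b₂ : ℝ → ℝ}
    (hb₁_cont : ContinuousOn b₁ (Ici 0)) (hb₂_cont : ContinuousOn b₂ (Ici 0))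
    (hb₁_int : IntegrableOn b₁ (Ici 0)) (hb₂_int : IntegrableOn b₂ (Ici 0))
    (hb₁0 : ∀ t, 0 ≤ t → 0 ≤ b₁ t) (hb₂0 : ∀ t, 0 ≤ t → 0 ≤ b₂ t) {p q R : ℝ}
    (hp : 1 < p) (hq : 1 < q) (hR : 0 < R) {u₀ u₁ v₀ v₁ : Space n → ℝ}
    (hv₀ : MemLp v₀ 2) (hv₁ : MemLp v₁ 2)
    (hu₀0 : 0 ≤ᵐ[volume] u₀) (hu₁0 : 0 ≤ᵐ[volume] u₁)
    (hv₀0 : 0 ≤ᵐ[volume] v₀) (hv₁0 : 0 ≤ᵐ[volume] v₁)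
    (hne : ¬ (v₀ =ᵐ[volume] 0 ∧ v₁ =ᵐ[volume] 0))
    (hv₀supp : ∀ᵐ x : Space n, R < ‖x‖ → v₀ x = 0)
    (hv₁supp : ∀ᵐ x : Space n, R < ‖x‖ → v₁ x = 0) :
    ∃ c, 0 < c ∧ ∀ (T : ℝ≥0∞) (u ut v vt : ℝ → L2 n) (Du Dv : ℝ → L2Vec n) (ε : ℝ), 0 < ε →
      EnergyClass T q u ut Du → EnergyClass T p v vt Dv →
      (u 0 =ᵐ[volume] fun x => ε * u₀ x) → (v 0 =ᵐ[volume] fun x => ε * v₀ x) →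
      WeakWaveEquation b₁ p ε u₁ T ut Du v → WeakWaveEquation b₂ q ε v₁ T vt Dv u →
      SupportedInCone R T u → SupportedInCone R T v → ∀ L, 1 ≤ L → 4 * L ∈ timeInterval T →
        ∀ t ∈ Icc (2 * L) (4 * L),
          c * ε ^ p * L ^ (((n : ℝ) - 1) * (1 - p / 2) + 2) ≤ ∫ x, u t x := by
  have hpos := integral_data_radialExp_pos hn hv₀ hv₁ hv₀0 hv₁0 hv₀supp hv₁supp hne
  obtain ⟨c₀, hc₀⟩ : ∃ c₀, c₀ = ((∫ x, v₀ x * radialExp n x) + ∫ x, v₁ x * radialExp n x) /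
      (4 * Real.exp (∫ r in Ici 0, b₂ r)) := ⟨_, rfl⟩
  have hc₀0 : 0 < c₀ := by rw [hc₀]; positivity
  obtain ⟨c, hc, H⟩ := exists_data_rpow_le_source hn hp hR hc₀0
  obtain ⟨M, hM⟩ : ∃ M, M = Real.exp (∫ r in Ici 0, b₁ r) := ⟨_, rfl⟩
  have hM0 : 0 < M := hM ▸ Real.exp_pos _
  refine ⟨c / (2 * M), by positivity, ?_⟩
  intro T u ut v vt Du Dv ε hε hu hv hu0 hv0 hue hve hus hvs L hL hT t ht
  have hLpos : 0 < L := by linarith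
  have hsrc := H T v vt Dv hv hvs ε hε (fun s hs hsT => by
    rw [hc₀]
    exact exp_le_integral_radialExp hn hb₂_cont hb₂_int hb₂0 hq hε hR hv₀0 hv₁0 hv₀supp hv₁supp
      hpos hv hu hv0 hve hvs hs hsT) L hL hT
  have h1 := le_integral_of_source_ge hb₁_cont hb₁_int hb₁0 hp hε hR hu₀0 hu₁0 hu hv hu0 hue
    hus hvs (a := L) (t := t) hLpos.le (by linarith [ht.1])
    (mem_timeInterval_of_le hT (by linarith [ht.1]) ht.2) (by
      filter_upwards [hsrc] with s hs hst
      exact hs ⟨hst.1, hst.2.trans ht.2⟩)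
  rw [← hM] at h1
  have h2 : L ^ 2 ≤ (t - L) ^ 2 := by
    have : L ≤ t - L := by linarith [ht.1]
    gcongr
  -- The source bound is integrated twice from `L`; `t - L ≥ L` on `[2L, 4L]` produces the extra `+
  -- 2` in the exponent.
  refine le_trans (le_of_eq_of_le ?_ (div_le_div_of_nonneg_right
    (mul_le_mul_of_nonneg_left h2 (by positivity)) (by positivity))) h1
  rw [Real.rpow_add hLpos, Real.rpow_two]
  ring

/-! ### The lifespan estimate. -/

/-- The maximal existence time is controlled by the exponent `F(n,q,p)` attached to the
component `u`. -/
theorem existenceTime_le {n : ℕ} (hn : 1 ≤ n) {b₁ b₂ : ℝ → ℝ}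
    (hb₁_cont : ContinuousOn b₁ (Ici 0)) (hb₂_cont : ContinuousOn b₂ (Ici 0))
    (hb₁_int : IntegrableOn b₁ (Ici 0)) (hb₂_int : IntegrableOn b₂ (Ici 0))
    (hb₁0 : ∀ t, 0 ≤ t → 0 ≤ b₁ t) (hb₂0 : ∀ t, 0 ≤ t → 0 ≤ b₂ t) {p q R : ℝ}
    (hp : 1 < p) (hq : 1 < q) (hF : 0 < F n q p) (hR : 0 < R) {u₀ u₁ v₀ v₁ : Space n → ℝ}
    (hv₀ : MemLp v₀ 2) (hv₁ : MemLp v₁ 2)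
    (hu₀0 : 0 ≤ᵐ[volume] u₀) (hu₁0 : 0 ≤ᵐ[volume] u₁)
    (hv₀0 : 0 ≤ᵐ[volume] v₀) (hv₁0 : 0 ≤ᵐ[volume] v₁)
    (hne : ¬ (v₀ =ᵐ[volume] 0 ∧ v₁ =ᵐ[volume] 0))
    (hv₀supp : ∀ᵐ x : Space n, R < ‖x‖ → v₀ x = 0)
    (hv₁supp : ∀ᵐ x : Space n, R < ‖x‖ → v₁ x = 0) :
    ∃ ε₀ : ℝ, 0 < ε₀ ∧ ∃ C : ℝ, 0 < C ∧ ∀ ε : ℝ, 0 < ε → ε ≤ ε₀ →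
      ∀ (T : ℝ≥0∞) (u v : ℝ → L2 n), IsEnergySolution b₁ b₂ p q ε u₀ u₁ v₀ v₁ T u v →
        SupportedInCone R T u → SupportedInCone R T v →
          T ≤ ENNReal.ofReal (C * ε ^ (-(F n q p)⁻¹)) := by
  obtain ⟨f, hf⟩ : ∃ f, f = F n q p := ⟨_, rfl⟩
  rw [← hf] at hF ⊢
  obtain ⟨cU, hcU, HU⟩ := exists_mean_step (q := q) n hb₁_cont hb₁_int hb₁0 hp hR hu₀0 hu₁0
  obtain ⟨cV, hcV, HV⟩ := exists_mean_step (q := p) n hb₂_cont hb₂_int hb₂0 hq hR hv₀0 hv₁0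
  obtain ⟨c₀, hc₀, H0⟩ := exists_mean_ge_of_data hn hb₁_cont hb₂_cont hb₁_int hb₂_int hb₁0 hb₂0
    hp hq hR hv₀ hv₁ hu₀0 hu₁0 hv₀0 hv₁0 hne hv₀supp hv₁supp
  obtain ⟨K, hK, HK⟩ := exists_blowup_threshold n (lt_min hcU hcV) hp hq
  have hp0 : 0 < p := by linarith
  -- With `κ^p = K/c₀` and `L^f = κ/ε` below, the data bound equals the blow-up threshold exactly,
  -- contradicting the strict inequality; `ε ≤ κ` ensures `L ≥ 1`.
  obtain ⟨κ, hκ⟩ : ∃ κ, κ = (K / c₀) ^ p⁻¹ := ⟨_, rfl⟩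
  have hκ0 : 0 < κ := by rw [hκ]; positivity
  have hκp : κ ^ p = K / c₀ := by rw [hκ, Real.rpow_inv_rpow (by positivity) hp0.ne']
  refine ⟨κ, hκ0, 4 * κ ^ f⁻¹, by positivity, fun ε hε hεκ T u v hsol hus hvs => ?_⟩
  obtain ⟨ut, vt, Du, Dv, hu, hv, hu0, hv0, hue, hve⟩ := hsol
  obtain ⟨L, hL⟩ : ∃ L, L = (κ / ε) ^ f⁻¹ := ⟨_, rfl⟩
  have hL1 : 1 ≤ L := by
    rw [hL]
    exact Real.one_le_rpow ((one_le_div hε).2 hεκ) (by positivity)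
  have hLpos : 0 < L := by linarith
  have hLf : L ^ f = κ / ε := by rw [hL, Real.rpow_inv_rpow (by positivity) hF.ne']
  have hCL : 4 * κ ^ f⁻¹ * ε ^ (-f⁻¹) = 4 * L := by
    rw [hL, Real.div_rpow hκ0.le hε.le, Real.rpow_neg hε.le]; ring
  rw [hCL]
  by_contra! hT
  have hmem : 4 * L ∈ timeInterval T := ⟨by linarith, hT⟩
  have hmin : ∀ {c' a k r : ℝ}, min cU cV ≤ c' → 0 ≤ k → ∀ δ : ℝ,
      min cU cV * L ^ a * k ^ r * δ ^ 2 ≤ c' * L ^ a * k ^ r * δ ^ 2 := fun hc' hk δ => by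
    gcongr
  have hlt := HK L (fun t => ∫ x, u t x) (fun t => ∫ x, v t x) hLpos
    (fun a ha k hk hks δ hδ t ht => (hmin (min_le_right _ _) hk δ).trans
      (HV T v vt u ut Dv Du ε hε hv hu hv0 hve hvs hus L hL1 hmem a ha k hk hks δ hδ t ht))
    (fun a ha k hk hks δ hδ t ht => (hmin (min_le_left _ _) hk δ).trans
      (HU T u ut v vt Du Dv ε hε hu hv hu0 hue hus hvs L hL1 hmem a ha k hk hks δ hδ t ht))
    _ (H0 T u ut v vt Du Dv ε hε hu hv hu0 hv0 hue hve hus hvs L hL1 hmem)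
  have hpq : 0 < p * q - 1 := by nlinarith
  -- This is where `F(n,q,p)` arises: `p f` is the gap between the exponent from the data and the
  -- threshold exponent.
  have hexp : ((n : ℝ) - 1) * (1 - p / 2) + 2 = p * f + (n - (2 * p + 2) / (p * q - 1)) := by
    rw [hf, F, mul_comm q p]
    field_simp
    ring
  rw [hexp, Real.rpow_add hLpos, ← mul_assoc] at hlt
  have h1 := lt_of_mul_lt_mul_right hlt (by positivity)
  rw [mul_comm p f, Real.rpow_mul hLpos.le, hLf, Real.div_rpow hκ0.le hε.le, hκp] at h1
  have hεp : 0 < ε ^ p := by positivity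
  have h2 : c₀ * ε ^ p * (K / c₀ / ε ^ p) = K := by field_simp
  rw [h2] at h1
  exact lt_irrefl _ h1

theorem IsEnergySolution.swap {n : ℕ} {b₁ b₂ : ℝ → ℝ} {p q ε : ℝ} {u₀ u₁ v₀ v₁ : Space n → ℝ}
    {T : ℝ≥0∞} {u v : ℝ → L2 n} (h : IsEnergySolution b₁ b₂ p q ε u₀ u₁ v₀ v₁ T u v) :
    IsEnergySolution b₂ b₁ q p ε v₀ v₁ u₀ u₁ T v u := by
  obtain ⟨ut, vt, Du, Dv, hu, hv, hu0, hv0, hue, hve⟩ := h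
  exact ⟨vt, ut, Dv, Du, hv, hu, hv0, hu0, hve, hue⟩

theorem lifespan_le {n : ℕ} {b₁ b₂ : ℝ → ℝ} {p q ε R : ℝ} {u₀ u₁ v₀ v₁ : Space n → ℝ}
    {T B : ℝ≥0∞} {u v : ℝ → L2 n}
    (h : ∀ (T' : ℝ≥0∞) (u' v' : ℝ → L2 n), IsEnergySolution b₁ b₂ p q ε u₀ u₁ v₀ v₁ T' u' v' →
      SupportedInCone R T' u' → SupportedInCone R T' v' → T' ≤ B) :
    lifespan b₁ b₂ p q ε u₀ u₁ v₀ v₁ R T u v ≤ B :=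
  sSup_le fun T' ⟨_, u', v', hs, hu, hv, _⟩ => h T' u' v' hs hu hv

end DampedWaveSystem

end

theorem theorem1p1
    (n : ℕ) (hn : 1 ≤ n)
    (b₁ b₂ : ℝ → ℝ)
    (hb₁_cont : ContinuousOn b₁ (Ici 0)) (hb₂_cont : ContinuousOn b₂ (Ici 0))
    (hb₁_int : IntegrableOn b₁ (Ici 0)) (hb₂_int : IntegrableOn b₂ (Ici 0))
    (hb₁_nonneg : ∀ t, 0 ≤ t → 0 ≤ b₁ t) (hb₂_nonneg : ∀ t, 0 ≤ t → 0 ≤ b₂ t)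
    (p q : ℝ) (hp : 1 < p) (hq : 1 < q)
    (hsub : ((n : ℝ) - 1) / 2 <
      max ((p + 2 + q⁻¹) / (p * q - 1)) ((q + 2 + p⁻¹) / (p * q - 1)))
    (R : ℝ) (hR : 0 < R)
    (u₀ u₁ v₀ v₁ : Space n → ℝ)
    (hu₀ : MemH1 u₀) (hv₀ : MemH1 v₀)
    (hu₁ : MemLp u₁ 2) (hv₁ : MemLp v₁ 2)
    (hu₀_nonneg : 0 ≤ᵐ[volume] u₀) (hu₁_nonneg : 0 ≤ᵐ[volume] u₁)
    (hv₀_nonneg : 0 ≤ᵐ[volume] v₀) (hv₁_nonneg : 0 ≤ᵐ[volume] v₁)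
    (hu_nontriv : ¬ (u₀ =ᵐ[volume] 0 ∧ u₁ =ᵐ[volume] 0))
    (hv_nontriv : ¬ (v₀ =ᵐ[volume] 0 ∧ v₁ =ᵐ[volume] 0))
    (hu₀_supp : ∀ᵐ x : Space n, R < ‖x‖ → u₀ x = 0)
    (hu₁_supp : ∀ᵐ x : Space n, R < ‖x‖ → u₁ x = 0)
    (hv₀_supp : ∀ᵐ x : Space n, R < ‖x‖ → v₀ x = 0)
    (hv₁_supp : ∀ᵐ x : Space n, R < ‖x‖ → v₁ x = 0) :
    ∃ ε₀ : ℝ, 0 < ε₀ ∧ ∃ C : ℝ, 0 < C ∧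
      ∀ ε : ℝ, 0 < ε → ε ≤ ε₀ →
        ∀ (T : ℝ≥0∞) (u v : ℝ → L2 n), 0 < T →
          IsEnergySolution b₁ b₂ p q ε u₀ u₁ v₀ v₁ T u v →
          SupportedInCone R T u → SupportedInCone R T v →
            lifespan b₁ b₂ p q ε u₀ u₁ v₀ v₁ R T u v < ⊤ ∧
            lifespan b₁ b₂ p q ε u₀ u₁ v₀ v₁ R T u v ≤
              ENNReal.ofReal (C * ε ^ (-(max (F n p q) (F n q p))⁻¹)) := by
  have hpos : 0 < max (F n p q) (F n q p) := by
    unfold F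
    rcases lt_max_iff.1 hsub with h | h
    · exact lt_max_of_lt_left (by linarith)
    · exact lt_max_of_lt_right (by rw [mul_comm q p]; linarith)
  obtain ⟨ε₀, hε₀, C, hC, H⟩ : ∃ ε₀ : ℝ, 0 < ε₀ ∧ ∃ C : ℝ, 0 < C ∧ ∀ ε : ℝ, 0 < ε → ε ≤ ε₀ →
      ∀ (T : ℝ≥0∞) (u v : ℝ → L2 n), IsEnergySolution b₁ b₂ p q ε u₀ u₁ v₀ v₁ T u v →
        SupportedInCone R T u → SupportedInCone R T v →
          T ≤ ENNReal.ofReal (C * ε ^ (-(max (F n p q) (F n q p))⁻¹)) := by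
    rcases le_total (F n p q) (F n q p) with h | h
    · rw [max_eq_right h] at hpos ⊢
      exact existenceTime_le hn hb₁_cont hb₂_cont hb₁_int hb₂_int hb₁_nonneg hb₂_nonneg hp hq
        hpos hR hv₀.1 hv₁ hu₀_nonneg hu₁_nonneg hv₀_nonneg hv₁_nonneg hv_nontriv hv₀_supp hv₁_supp
    · rw [max_eq_left h] at hpos ⊢
      obtain ⟨ε₀, hε₀, C, hC, H⟩ := existenceTime_le hn hb₂_cont hb₁_cont hb₂_int hb₁_int
        hb₂_nonneg hb₁_nonneg hq hp hpos hR hu₀.1 hu₁ hv₀_nonneg hv₁_nonneg hu₀_nonneg hu₁_nonneg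
        hu_nontriv hu₀_supp hu₁_supp
      exact ⟨ε₀, hε₀, C, hC, fun ε hε hεε₀ T u v hs hu hv => H ε hε hεε₀ T v u hs.swap hv hu⟩
  -- `H` bounds the existence time of every solution supported in the cone, hence that of every
  -- extension entering the lifespan.
  refine ⟨ε₀, hε₀, C, hC, fun ε hε hεε₀ T u v _ _ _ _ => ?_⟩
  have hle := lifespan_le (R := R) (T := T) (u := u) (v := v) (H ε hε hεε₀)
  exact ⟨hle.trans_lt ENNReal.ofReal_lt_top, hle⟩
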